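/- **Setting.** A homogeneous rumor spreading process on $n$ nodes proceeds in rounds. It starts with exactly one informed node and informed nodes stay informed. Whenever a round starts with $k$ informed nodes then, whatever happened before, each uninformed node becomes informed in this round with probability $p_k$, a number depending only on $k$ (memoryless processes are a special case). The covariance number $c_k$ is the smallest number such that, in every round starting with $k$ informed nodes and conditionally on the past, the indicators $X_1,X_2$ of the events that two distinct uninformed nodes become informed satisfy $\operatorname{Cov}[X_1,X_2]\le c_k$. Let $I_t$ be the number of informed nodes at the end of round $t$ ($I_0=1$), and for real $m$ let $T(1,m)=\min\{t\ge 0 : I_t\ge m\}\in\mathbb N\cup\{\infty\}$. Fix constants $0<\gamma_0\le\gamma_1$, $a,b,c\ge 0$ and $0<f<1$. For $\gamma_n\in[\gamma_0,\gamma_1]$, the process on $n$ nodes satisfies the *upper* (respectively *lower*) exponential growth conditions in $[1,fn[$ if for all integers $1\le k<fn$ $$p_k\ge\gamma_n\tfrac kn\Bigl(1-a\tfrac kn-\tfrac b{\ln n}\Bigr)\quad\Bigl(\text{respectively } p_k\le\gamma_n\tfrac kn\Bigl(1+a\tfrac kn+\tfrac b{\ln n}\Bigr)\Bigr)\qquad\text{and}\qquad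 c_k\le c\,\tfrac k{n^2}.$$ **Theorem.** All constants below depend only on $\gamma_0,\gamma_1,a,b,c,f$ (and, in (3), on $\kappa,q$). 1. If $af<1$, there are constants $C\in\mathbb R$, $A',\alpha'>0$ and $N\in\mathbb N$ such that for all $n\ge N$ every homogeneous rumor spreading process on $n$ nodes satisfying the upper exponential growth conditions in $[1,fn[$ satisfies $$\mathbb E[T(1,fn)]\le\log_{1+\gamma_n}n+C,\qquad \Pr[T(1,fn)\ge\log_{1+\gamma_n}n+r]\le A'e^{-\alpha' r}\ \text{ for all } r\in\mathbb N.$$ 2. There are constants $C\in\mathbb R$, $A',\alpha'>0$ and $N\in\mathbb N$ such that for all $n\ge N$ every homogeneous rumor spreading process on $n$ nodes satisfying the lower exponential growth conditions in $[1,fn[$ satisfies $$\mathbb E[T(1,fn)]\ge\log_{1+\gamma_n}n-C,\qquad \Pr[T(1,fn)\le\log_{1+\gamma_n}n-r]\le A'e^{-\alpha' r}\ \text{ for all } r\in\mathbb N.$$ 3. For all $\kappa>0$ and $q<1$ there are $f'\in\,]f,1[$, $D\in\mathbb R$ and $N\in\mathbb N$ such that for all $n\ge N$ and every homogeneous rumor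 spreading process on $n$ nodes which satisfies the lower exponential growth conditions in $[1,fn[$ and, in addition, $\kappa\tfrac kn\le p_k\le q$ for all $1\le k<fn$, the probability that $T(1,fn)$ is finite and more than $f'n$ nodes are informed at the end of round $T(1,fn)$ is at most $D/n$. -/

import Mathlib

open MeasureTheory ProbabilityTheory
open scoped ENNReal

/-- A homogeneous rumor spreading process on `n` nodes, realised on a probability space `(Ω, μ)`.
`informed t ω` is the set of informed nodes at the end of round `t`. Exactly one node is informed
at the start, and informed nodes stay informed. Whatever the history of the process up to
round `t` is, if `k` nodes are informed at the end of round `t` then every uninformed node becomes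
informed in round `t + 1` with probability `p k`. Memoryless processes (where the next round
depends on the current set of informed nodes only) are a special case. -/
structure HomogeneousRumorProcess (n : ℕ) {Ω : Type*} [MeasurableSpace Ω] (μ : Measure Ω) where
  /-- the set of informed nodes at the end of round `t` -/
  informed : ℕ → Ω → Finset (Fin n)
  measurableSet_informed : ∀ (t : ℕ) (S : Finset (Fin n)), MeasurableSet {ω | informed t ω = S}
  card_informed_zero : ∀ ω, (informed 0 ω).card = 1
  informed_subset_succ : ∀ t ω, informed t ω ⊆ informed (t + 1) ω
  /-- the success probabilities -/
  p : ℕ → ℝ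
  prob_informed_succ : ∀ (t : ℕ) (h : ℕ → Finset (Fin n)),
    μ {ω | ∀ s ≤ t, informed s ω = h s} ≠ 0 → ∀ x ∉ h t,
      (μ[| {ω | ∀ s ≤ t, informed s ω = h s}]).real {ω | x ∈ informed (t + 1) ω} = p (h t).card

namespace HomogeneousRumorProcess

variable {n : ℕ} {Ω : Type*} [MeasurableSpace Ω] {μ : Measure Ω}

/-- The event that the first `t` rounds of the process follow the history `h`. -/
def historyEvent (P : HomogeneousRumorProcess n μ) (t : ℕ) (h : ℕ → Finset (Fin n)) : Set Ω :=
  {ω | ∀ s ≤ t, P.informed s ω = h s}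

/-- The indicator random variable of the event that `x` is informed at the end of round `t`. -/
noncomputable def informedIndicator (P : HomogeneousRumorProcess n μ) (t : ℕ) (x : Fin n) : Ω → ℝ :=
  {ω | x ∈ P.informed t ω}.indicator 1

/-- All covariances, in a round starting with `k` informed nodes (after any history of positive
probability), of the indicators of the events that two given distinct uninformed nodes become
informed in this round. -/
def covarianceSet (P : HomogeneousRumorProcess n μ) (k : ℕ) : Set ℝ :=
  {v | ∃ (t : ℕ) (h : ℕ → Finset (Fin n)) (x y : Fin n),
    μ (P.historyEvent t h) ≠ 0 ∧ (h t).card = k ∧ x ∉ h t ∧ y ∉ h t ∧ x ≠ y ∧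
    v = cov[P.informedIndicator (t + 1) x, P.informedIndicator (t + 1) y;
          μ[| P.historyEvent t h]]}

/-- The covariance number `c_k`: the smallest upper bound of these covariances
(see `isLUB_covNumber`; it is `0` if there are none). -/
noncomputable def covNumber (P : HomogeneousRumorProcess n μ) (k : ℕ) : ℝ :=
  sSup (P.covarianceSet k)

/-- The time `T(1, m)` (in rounds, from the start of the process with one informed node) until at
least `m` nodes are informed; it is `⊤` if this never happens. -/
noncomputable def spreadingTime (P : HomogeneousRumorProcess n μ) (m : ℝ) (ω : Ω) : ℕ∞ :=
  ⨅ (t : ℕ) (_ : m ≤ ((P.informed t ω).card : ℝ)), (t : ℕ∞)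

/-- The inequalities of the upper exponential growth conditions in `[1, f n[`, for this `n`. -/
def UpperExpGrowth (P : HomogeneousRumorProcess n μ) (γ a b c f : ℝ) : Prop :=
  ∀ k : ℕ, 1 ≤ k → (k : ℝ) < f * n →
    γ * (k / n) * (1 - a * (k / n) - b / Real.log n) ≤ P.p k ∧
    P.covNumber k ≤ c * (k / (n : ℝ) ^ 2)

/-- The inequalities of the lower exponential growth conditions in `[1, f n[`, for this `n`. -/
def LowerExpGrowth (P : HomogeneousRumorProcess n μ) (γ a b c f : ℝ) : Prop :=
  ∀ k : ℕ, 1 ≤ k → (k : ℝ) < f * n →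
    P.p k ≤ γ * (k / n) * (1 + a * (k / n) + b / Real.log n) ∧
    P.covNumber k ≤ c * (k / (n : ℝ) ^ 2)

theorem measurableSet_mem_informed (P : HomogeneousRumorProcess n μ) (t : ℕ) (x : Fin n) :
    MeasurableSet {ω | x ∈ P.informed t ω} := by
  have : {ω | x ∈ P.informed t ω} =
      ⋃ S ∈ {S : Finset (Fin n) | x ∈ S}, {ω | P.informed t ω = S} := by
    ext ω; simp
  rw [this]
  exact MeasurableSet.biUnion (Set.to_countable _) fun S _ => P.measurableSet_informed t S

theorem bddAbove_covarianceSet [IsFiniteMeasure μ] (P : HomogeneousRumorProcess n μ) (k : ℕ) :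
    BddAbove (P.covarianceSet k) := by
  refine ⟨1, ?_⟩
  rintro v ⟨t, h, x, y, hpos, -, -, -, -, rfl⟩
  have : IsProbabilityMeasure (μ[| P.historyEvent t h]) := cond_isProbabilityMeasure hpos
  set ν := μ[| P.historyEvent t h]
  have hb : ∀ z ω, 0 ≤ P.informedIndicator (t + 1) z ω ∧ P.informedIndicator (t + 1) z ω ≤ 1 := by
    intro z ω
    unfold informedIndicator Set.indicator
    split <;> simp
  have hm : ∀ z, Measurable (P.informedIndicator (t + 1) z) := fun z =>
    measurable_one.indicator (P.measurableSet_mem_informed (t + 1) z)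
  have hL : ∀ z, MemLp (P.informedIndicator (t + 1) z) 2 ν := fun z =>
    MemLp.of_bound (hm z).aestronglyMeasurable 1 (Filter.Eventually.of_forall fun ω => by
      rw [Real.norm_of_nonneg (hb z ω).1]; exact (hb z ω).2)
  rw [covariance_eq_sub (hL x) (hL y)]
  have h1 : ∫ ω, (P.informedIndicator (t + 1) x * P.informedIndicator (t + 1) y) ω ∂ν ≤ 1 := by
    calc _ ≤ ∫ _, (1 : ℝ) ∂ν := by
          refine integral_mono ((hL x).integrable_mul (hL y)) (integrable_const _) fun ω => ?_
          exact mul_le_one₀ (hb x ω).2 (hb y ω).1 (hb y ω).2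
      _ = 1 := by simp
  have h2 : ∀ z, 0 ≤ ∫ ω, P.informedIndicator (t + 1) z ω ∂ν := fun z =>
    integral_nonneg fun ω => (hb z ω).1
  have := mul_nonneg (h2 x) (h2 y)
  linarith

theorem isLUB_covNumber [IsFiniteMeasure μ] (P : HomogeneousRumorProcess n μ) (k : ℕ)
    (hk : (P.covarianceSet k).Nonempty) : IsLUB (P.covarianceSet k) (P.covNumber k) :=
  isLUB_csSup hk (P.bddAbove_covarianceSet k)

end HomogeneousRumorProcess

/-! Given the past, a round starting with `k` informed nodes ends with a number `Z ≥ k` of mean `k +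
m`, `m = (n - k) p_k`, and variance at most `m + c k`. Everything follows from these moments by
following the mean of a suitable function of the number of informed nodes and applying Markov's
inequality. Write `w = b / ln n` and `L = log_{1+γ} n`. Over about `L` rounds a factor `1 ± w` per
round costs only a constant, because `w L = b / ln (1 + γ)`.

Lower bounds for the time: the concave potential `N y / (N + y)`, with `N` a small constant times
`n`, grows in mean by at most `(1 + γ)(1 + w)` per round. By Jensen's inequality only the mean
matters, and the flattening of the potential outweighs the acceleration `a k / n`. Truncating at `θ
= ε n` makes this valid at every state, and Markov gives `Pr[I_t ≥ θ] ≤ 2 Λ ^ t / θ`.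

Upper bounds: the potential is `R(y) = 1 / y - 1 / (N + y)`. Its extra steepness compensates for the
slowdown near `n`, so `R` at the mean of `Z` is smaller than `R(k)` by a factor of at least `(1 +
γ)(1 - w)`. The variance multiplies this by `1 + C / k`, which is not summable at once, since the
process may linger at small `k`. The remedy is the potential `R ^ s + D / y` with small `s`: the
first summand then contracts slowly, `1 / y` contracts by the fixed factor `1 - c₀`
(`integral_div_le`), and the surplus contraction of `D / y` pays for the error
(`integral_potential_le`). From `ε n` to `f n` the potential `y ^ (-s)` with a constant contraction
suffices. Of `r` surplus rounds half go to either phase, which gives an exponential tail.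

Overshooting: Chebyshev bounds the probability that a round jumps from below `f n` to above `f' n`
by `O(1 / n ^ 2)` times the expected gain of that round. The expected gains telescope to at most
`n`, so the total is `O(1 / n)` (`measure_overshoot_le`). -/

namespace HomogeneousRumorProcess

/-! ### Measurability, and reduction of expectations to histories -/

section Basic

variable {n : ℕ} {Ω : Type*} [MeasurableSpace Ω] {μ : Measure Ω}

theorem measurable_comp_informed (P : HomogeneousRumorProcess n μ) (t : ℕ)
    {β : Type*} [MeasurableSpace β] (φ : Finset (Fin n) → β) :
    Measurable fun ω => φ (P.informed t ω) := by
  let : MeasurableSpace (Finset (Fin n)) := ⊤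
  have h : Measurable (P.informed t) :=
    measurable_to_countable' fun S => P.measurableSet_informed t S
  exact measurable_from_top.comp h

theorem memLp_comp_informed (P : HomogeneousRumorProcess n μ) (t : ℕ)
    (φ : Finset (Fin n) → ℝ) (q : ℝ≥0∞) (ν : Measure Ω) [IsFiniteMeasure ν] :
    MemLp (fun ω => φ (P.informed t ω)) q ν :=
  MemLp.of_bound (P.measurable_comp_informed t φ).aestronglyMeasurable (∑ S, ‖φ S‖)
    (Filter.Eventually.of_forall fun _ =>
      Finset.single_le_sum (f := fun S => ‖φ S‖) (fun _ _ => norm_nonneg _) (Finset.mem_univ _))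

theorem integrable_comp_informed (P : HomogeneousRumorProcess n μ) (t : ℕ)
    (φ : Finset (Fin n) → ℝ) (ν : Measure Ω) [IsFiniteMeasure ν] :
    Integrable (fun ω => φ (P.informed t ω)) ν :=
  memLp_one_iff_integrable.1 (P.memLp_comp_informed t φ 1 ν)

/-- The number of informed nodes at the end of round `t`. -/
noncomputable def count (P : HomogeneousRumorProcess n μ) (t : ℕ) (ω : Ω) : ℝ :=
  ((P.informed t ω).card : ℝ)

theorem measurable_count (P : HomogeneousRumorProcess n μ) (t : ℕ) : Measurable (P.count t) :=
  P.measurable_comp_informed t fun S => (S.card : ℝ)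

theorem integrable_comp_count (P : HomogeneousRumorProcess n μ) (t : ℕ)
    (φ : ℝ → ℝ) (ν : Measure Ω) [IsFiniteMeasure ν] :
    Integrable (fun ω => φ (P.count t ω)) ν :=
  P.integrable_comp_informed t (fun S => φ (S.card : ℝ)) ν

theorem integrable_count (P : HomogeneousRumorProcess n μ) (t : ℕ)
    (ν : Measure Ω) [IsFiniteMeasure ν] : Integrable (P.count t) ν :=
  P.integrable_comp_count t id ν

theorem count_zero (P : HomogeneousRumorProcess n μ) (ω : Ω) : P.count 0 ω = 1 := by
  simp [count, P.card_informed_zero ω]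

theorem count_le (P : HomogeneousRumorProcess n μ) (t : ℕ) (ω : Ω) : P.count t ω ≤ n := by
  have := Finset.card_le_univ (P.informed t ω)
  rw [Fintype.card_fin] at this
  exact Nat.cast_le.2 this

theorem count_mono (P : HomogeneousRumorProcess n μ) (ω : Ω) : Monotone fun t => P.count t ω :=
  monotone_nat_of_le_succ fun t => by
    exact Nat.cast_le.2 (Finset.card_le_card (P.informed_subset_succ t ω))

theorem one_le_count (P : HomogeneousRumorProcess n μ) (t : ℕ) (ω : Ω) : 1 ≤ P.count t ω := by
  rw [← P.count_zero ω]
  exact P.count_mono ω (Nat.zero_le t)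

theorem measurableSet_historyEvent (P : HomogeneousRumorProcess n μ) (t : ℕ)
    (h : ℕ → Finset (Fin n)) : MeasurableSet (P.historyEvent t h) := by
  have : P.historyEvent t h = ⋂ s ∈ Set.Iic t, {ω | P.informed s ω = h s} := by
    ext ω; simp [historyEvent]
  rw [this]
  exact MeasurableSet.biInter (Set.to_countable _) fun s _ => P.measurableSet_informed s _

theorem cond_historyEvent_ae (P : HomogeneousRumorProcess n μ) (t : ℕ)
    (h : ℕ → Finset (Fin n)) : ∀ᵐ ω ∂μ[| P.historyEvent t h], P.informed t ω = h t := by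
  filter_upwards [ae_cond_mem (P.measurableSet_historyEvent t h)] with ω hω
  exact hω t le_rfl

/-- An inequality between integrals holds if it holds conditionally on every history. -/
theorem integral_le_of_cond [IsProbabilityMeasure μ] (P : HomogeneousRumorProcess n μ) (t : ℕ)
    {F G : Ω → ℝ} (hF : Integrable F μ) (hG : Integrable G μ)
    (H : ∀ h, μ (P.historyEvent t h) ≠ 0 →
      ∫ ω, F ω ∂μ[| P.historyEvent t h] ≤ ∫ ω, G ω ∂μ[| P.historyEvent t h]) :
    ∫ ω, F ω ∂μ ≤ ∫ ω, G ω ∂μ := by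
  -- Only the values up to round `t` matter for `historyEvent t`, so the padding by `∅` is harmless;
  -- the finitely many events obtained this way partition `Ω`.
  let e : (Fin (t + 1) → Finset (Fin n)) → ℕ → Finset (Fin n) :=
    fun b s => if hs : s < t + 1 then b ⟨s, hs⟩ else ∅
  have hun : ⋃ b, P.historyEvent t (e b) = Set.univ := by
    refine Set.eq_univ_of_forall fun ω => Set.mem_iUnion.2 ⟨fun s => P.informed s ω, ?_⟩
    intro s hs
    simp only [e, dif_pos (Nat.lt_succ_of_le hs)]
  have hdis : Pairwise (Function.onFun Disjoint fun b => P.historyEvent t (e b)) := by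
    intro b b' hbb
    refine Set.disjoint_left.2 fun ω hω hω' => hbb ?_
    funext s
    have h1 := hω s (Nat.le_of_lt_succ s.2)
    have h2 := hω' s (Nat.le_of_lt_succ s.2)
    simp only [e, s.2, dite_true] at h1 h2
    exact h1.symm.trans h2
  have hms := fun b => P.measurableSet_historyEvent t (e b)
  have key : ∀ K : Ω → ℝ, Integrable K μ →
      ∫ ω, K ω ∂μ = ∑ b, ∫ ω in P.historyEvent t (e b), K ω ∂μ := by
    intro K hK
    rw [← setIntegral_univ, ← hun, integral_iUnion_fintype hms hdis fun b => hK.integrableOn]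
  rw [key F hF, key G hG]
  refine Finset.sum_le_sum fun b _ => ?_
  by_cases h0 : μ (P.historyEvent t (e b)) = 0
  · simp [Measure.restrict_eq_zero.2 h0]
  · have := H _ h0
    rw [ProbabilityTheory.cond, integral_smul_measure, integral_smul_measure] at this
    refine le_of_mul_le_mul_left this ?_
    exact ENNReal.toReal_pos (ENNReal.inv_ne_zero.2 (measure_ne_top _ _))
      (ENNReal.inv_ne_top.2 h0)

/-! ### Conditional mean and variance of one round -/

section Cond

variable (P : HomogeneousRumorProcess n μ) (t : ℕ)
  (h : ℕ → Finset (Fin n))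

theorem count_succ_ae_eq :
    ∀ᵐ ω ∂μ[| P.historyEvent t h],
      P.count (t + 1) ω = (h t).card + ∑ x ∈ (h t)ᶜ, P.informedIndicator (t + 1) x ω := by
  filter_upwards [P.cond_historyEvent_ae t h] with ω hω
  have hsub : h t ⊆ P.informed (t + 1) ω := hω ▸ P.informed_subset_succ t ω
  have h1 : ∑ x ∈ (h t)ᶜ, P.informedIndicator (t + 1) x ω
      = ((P.informed (t + 1) ω \ h t).card : ℝ) := by
    have : P.informed (t + 1) ω \ h t = (h t)ᶜ.filter (fun x => x ∈ P.informed (t + 1) ω) := by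
      ext x; simp [and_comm]
    rw [this, Finset.card_filter]
    push_cast
    refine Finset.sum_congr rfl fun x _ => ?_
    simp [informedIndicator, Set.indicator]
  rw [h1, count, ← Finset.card_sdiff_add_card_eq_card hsub]
  push_cast; ring

theorem memLp_informedIndicator (x : Fin n) (q : ℝ≥0∞) (ν : Measure Ω) [IsFiniteMeasure ν] :
    MemLp (P.informedIndicator t x) q ν := by
  classical
  have : P.informedIndicator t x = fun ω => (if x ∈ P.informed t ω then 1 else 0 : ℝ) := by
    ext ω; simp [informedIndicator, Set.indicator]
  rw [this]
  exact P.memLp_comp_informed t (fun S => if x ∈ S then 1 else 0) q ν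

theorem integral_informedIndicator (hpos : μ (P.historyEvent t h) ≠ 0) {x : Fin n}
    (hx : x ∉ h t) :
    ∫ ω, P.informedIndicator (t + 1) x ω ∂μ[| P.historyEvent t h] = P.p (h t).card := by
  rw [informedIndicator, integral_indicator_one (P.measurableSet_mem_informed _ _)]
  exact P.prob_informed_succ t h hpos x hx

/-- The expected number of nodes newly informed in a round. -/
noncomputable def meanGain (P : HomogeneousRumorProcess n μ) (k : ℕ) : ℝ := (n - k) * P.p k

theorem card_compl_cast (S : Finset (Fin n)) : ((Sᶜ.card : ℕ) : ℝ) = n - S.card := by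
  rw [Finset.card_compl, Nat.cast_sub (Finset.card_le_univ S), Fintype.card_fin]

theorem integral_count_succ [IsProbabilityMeasure μ]
    (hpos : μ (P.historyEvent t h) ≠ 0) :
    ∫ ω, P.count (t + 1) ω ∂μ[| P.historyEvent t h] = (h t).card + P.meanGain (h t).card := by
  have := cond_isProbabilityMeasure hpos
  rw [integral_congr_ae (P.count_succ_ae_eq t h), integral_add (integrable_const _)
    (integrable_finsetSum _ fun x _ => memLp_one_iff_integrable.1
      (P.memLp_informedIndicator (t + 1) x 1 _)),
    integral_finsetSum _ fun x _ => memLp_one_iff_integrable.1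
      (P.memLp_informedIndicator (t + 1) x 1 _),
    Finset.sum_congr rfl fun x hx => P.integral_informedIndicator t h hpos
      (Finset.mem_compl.1 hx)]
  simp [meanGain, Finset.card_compl, Nat.cast_sub (Fintype.card_fin n ▸ Finset.card_le_univ (h t))]

/-- The variance of a sum of indicators is the sum of all covariances: the diagonal contributes at
most `n - k` times `p_k`, which is the mean gain, and there are at most `n ^ 2` further terms, each
at most `v`. -/
theorem integral_sq_count_succ_sub_le [IsProbabilityMeasure μ]
    (hpos : μ (P.historyEvent t h) ≠ 0) {v : ℝ} (hv : 0 ≤ v)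
    (hcov : P.covNumber (h t).card ≤ v) :
    ∫ ω, (P.count (t + 1) ω - ((h t).card + P.meanGain (h t).card)) ^ 2 ∂μ[| P.historyEvent t h]
      ≤ P.meanGain (h t).card + (n : ℝ) ^ 2 * v := by
  have := cond_isProbabilityMeasure hpos
  set ν := μ[| P.historyEvent t h] with hν
  have hmem := fun x => P.memLp_informedIndicator (t + 1) x 2 ν
  have hvar : ∫ ω, (P.count (t + 1) ω - ((h t).card + P.meanGain (h t).card)) ^ 2 ∂ν
      = Var[∑ x ∈ (h t)ᶜ, P.informedIndicator (t + 1) x; ν] := by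
    rw [variance_eq_integral
      (Finset.aemeasurable_sum _ fun x _ => (hmem x).aestronglyMeasurable.aemeasurable)]
    have hmean := P.integral_count_succ t h hpos
    rw [integral_congr_ae (P.count_succ_ae_eq t h), integral_add (integrable_const _)
      (integrable_finsetSum _ fun x _ => (hmem x).integrable (by norm_num))] at hmean
    refine integral_congr_ae ?_
    filter_upwards [P.count_succ_ae_eq t h] with ω hω
    rw [hω, ← hmean]
    simp only [Finset.sum_apply, integral_const, probReal_univ, smul_eq_mul, one_mul]
    ring
  rw [hvar, variance_sum' fun x _ => hmem x]
  -- Adding `v` on the diagonal as well is allowed by `0 ≤ v` and makes the double sum uniform.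
  have hp : ∀ x ∈ (h t)ᶜ, ∀ y ∈ (h t)ᶜ,
      cov[P.informedIndicator (t + 1) x, P.informedIndicator (t + 1) y; ν]
        ≤ (if x = y then P.p (h t).card else 0) + v := by
    intro x hx y hy
    rw [Finset.mem_compl] at hx hy
    split_ifs with hxy
    · subst hxy
      rw [covariance_eq_sub (hmem x) (hmem x)]
      have h1 : ∫ ω, (P.informedIndicator (t + 1) x * P.informedIndicator (t + 1) x) ω ∂ν
          = P.p (h t).card := by
        rw [← P.integral_informedIndicator t h hpos hx]
        refine integral_congr_ae (Filter.Eventually.of_forall fun ω => ?_)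
        simp only [Pi.mul_apply, informedIndicator, Set.indicator]
        split <;> simp
      rw [h1]
      nlinarith [mul_self_nonneg (∫ ω, P.informedIndicator (t + 1) x ω ∂ν)]
    · rw [zero_add]
      refine le_trans (le_csSup (P.bddAbove_covarianceSet _) ?_) hcov
      exact ⟨t, h, x, y, hpos, rfl, hx, hy, hxy, rfl⟩
  have hcard : ((h t)ᶜ.card : ℝ) ≤ n := by
    exact_mod_cast (Finset.card_le_univ _).trans_eq (Fintype.card_fin n)
  calc _ ≤ ∑ x ∈ (h t)ᶜ, ∑ y ∈ (h t)ᶜ, ((if x = y then P.p (h t).card else 0) + v) :=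
        Finset.sum_le_sum fun x hx => Finset.sum_le_sum fun y hy => hp x hx y hy
    _ = P.meanGain (h t).card + ((h t)ᶜ.card : ℝ) ^ 2 * v := by
        simp only [Finset.sum_add_distrib, Finset.sum_const, nsmul_eq_mul]
        rw [meanGain, ← card_compl_cast (h t)]
        have : ∀ x ∈ (h t)ᶜ, (∑ y ∈ (h t)ᶜ, if x = y then P.p (h t).card else 0)
            = P.p (h t).card := by
          intro x hx
          rw [Finset.sum_ite_eq, if_pos hx]
        rw [Finset.sum_congr rfl this]
        simp only [Finset.sum_const, nsmul_eq_mul]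
        ring
    _ ≤ _ := by gcongr

theorem count_ae_eq :
    ∀ᵐ ω ∂μ[| P.historyEvent t h], P.count t ω = (h t).card := by
  filter_upwards [P.cond_historyEvent_ae t h] with ω hω
  rw [count, hω]

theorem card_history_pos (hpos : μ (P.historyEvent t h) ≠ 0) : 1 ≤ (h t).card := by
  obtain ⟨ω, hω⟩ := nonempty_of_measure_ne_zero hpos
  have := P.one_le_count t ω
  rw [count, hω t le_rfl] at this
  exact_mod_cast this

theorem card_history_le : ((h t).card : ℝ) ≤ n := by
  exact_mod_cast (Finset.card_le_univ _).trans_eq (Fintype.card_fin n)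

end Cond

/-! ### The spreading time through the events that few nodes are informed -/

section SpreadingTime

theorem spreadingTime_le_iff (P : HomogeneousRumorProcess n μ) (m : ℝ) (ω : Ω) (t : ℕ) :
    P.spreadingTime m ω ≤ t ↔ m ≤ P.count t ω := by
  constructor
  · intro hle
    by_contra hlt
    have : ((t + 1 : ℕ) : ℕ∞) ≤ P.spreadingTime m ω := by
      refine le_iInf₂ fun s hs => ?_
      have : t < s := by
        by_contra hst
        exact hlt (hs.trans (P.count_mono ω (not_lt.1 hst)))
      exact_mod_cast this
    have := this.trans hle
    have : t + 1 ≤ t := by exact_mod_cast this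
    omega
  · intro hm
    exact iInf₂_le t hm

theorem lt_spreadingTime_iff (P : HomogeneousRumorProcess n μ) (m : ℝ) (ω : Ω) (t : ℕ) :
    (t : ℕ∞) < P.spreadingTime m ω ↔ P.count t ω < m := by
  rw [← not_le, spreadingTime_le_iff, not_le]

theorem measurableSet_count_lt (P : HomogeneousRumorProcess n μ) (m : ℝ) (t : ℕ) :
    MeasurableSet {ω | P.count t ω < m} :=
  measurableSet_lt (P.measurable_count t) measurable_const

theorem tsum_indicator_lt_enat (T : ℕ∞) :
    ∑' t : ℕ, ({s : ℕ | (s : ℕ∞) < T}.indicator 1 t : ℝ≥0∞) = T := by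
  rw [← tsum_subtype]
  simp only [Pi.one_apply, ENNReal.tsum_set_one]
  congr 1
  induction T using ENat.recTopCoe with
  | top => simp
  | coe m =>
    have : {s : ℕ | (s : ℕ∞) < (m : ℕ∞)} = (Finset.range m : Set ℕ) := by
      ext s; simp
    rw [this, Set.encard_coe_eq_coe_finsetCard, Finset.card_range]

/-- The tail-sum formula `E[T] = ∑ Pr[T > t]`. It is stated in `[0, ∞]`, so that the value `⊤` of
the spreading time is covered. -/
theorem lintegral_spreadingTime (P : HomogeneousRumorProcess n μ) (m : ℝ) :
    ∫⁻ ω, (P.spreadingTime m ω : ℝ≥0∞) ∂μ = ∑' t, μ {ω | P.count t ω < m} := by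
  have : ∀ ω, (P.spreadingTime m ω : ℝ≥0∞)
      = ∑' t : ℕ, ({ω | P.count t ω < m}.indicator 1 ω : ℝ≥0∞) := by
    intro ω
    rw [← tsum_indicator_lt_enat]
    refine tsum_congr fun t => ?_
    simp only [Set.indicator, Set.mem_ofPred_eq, lt_spreadingTime_iff, Pi.one_apply]
  simp_rw [this]
  rw [lintegral_tsum fun t =>
    (measurable_one.indicator (P.measurableSet_count_lt m t)).aemeasurable]
  refine tsum_congr fun t => ?_
  rw [lintegral_indicator_one (P.measurableSet_count_lt m t)]

end SpreadingTime

end Basic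

end HomogeneousRumorProcess

/-! ### Estimates from the first two moments of a round -/

/-- `Z` is at least `k`, has mean `k + m` and variance at most `V` under `ν`; every function of `Z`
is integrable. -/
structure GainMoments {Ω : Type*} [MeasurableSpace Ω] (ν : Measure Ω) (Z : Ω → ℝ)
    (k m V : ℝ) : Prop where
  isProbabilityMeasure : IsProbabilityMeasure ν
  integrable_comp : ∀ φ : ℝ → ℝ, Integrable (fun ω => φ (Z ω)) ν
  le_ae : ∀ᵐ ω ∂ν, k ≤ Z ω
  integral_eq : ∫ ω, Z ω ∂ν = k + m
  integral_sq_le : ∫ ω, (Z ω - (k + m)) ^ 2 ∂ν ≤ V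

namespace GainMoments

variable {Ω : Type*} [MeasurableSpace Ω] {ν : Measure Ω} {Z : Ω → ℝ} {k m V : ℝ}

theorem nonneg (h : GainMoments ν Z k m V) : 0 ≤ m := by
  have := h.isProbabilityMeasure
  have h1 : ∫ _, k ∂ν ≤ ∫ ω, Z ω ∂ν :=
    integral_mono_ae (integrable_const _) (h.integrable_comp id) h.le_ae
  rw [h.integral_eq] at h1
  simp at h1
  exact h1

/-- The linear term is centred at the mean and integrates to zero. This reduces the following moment
estimates to pointwise quadratic majorants on `[k, ∞)`. -/
theorem integral_le_of_le_quadratic (h : GainMoments ν Z k m V) {φ : ℝ → ℝ} {A B C : ℝ}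
    (hC : 0 ≤ C) (hφ : ∀ z, k ≤ z → φ z ≤ A + B * (z - (k + m)) + C * (z - (k + m)) ^ 2) :
    ∫ ω, φ (Z ω) ∂ν ≤ A + C * V := by
  have := h.isProbabilityMeasure
  have i1 : Integrable (fun ω => A + B * (Z ω - (k + m))) ν :=
    h.integrable_comp fun z => A + B * (z - (k + m))
  have i2 : Integrable (fun ω => C * (Z ω - (k + m)) ^ 2) ν :=
    h.integrable_comp fun z => C * (z - (k + m)) ^ 2
  have i3 : Integrable (fun ω => B * (Z ω - (k + m))) ν :=
    h.integrable_comp fun z => B * (z - (k + m))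
  have i4 : Integrable Z ν := h.integrable_comp id
  calc ∫ ω, φ (Z ω) ∂ν
      ≤ ∫ ω, (A + B * (Z ω - (k + m)) + C * (Z ω - (k + m)) ^ 2) ∂ν := by
        refine integral_mono_ae (h.integrable_comp φ) (i1.add i2) ?_
        filter_upwards [h.le_ae] with ω hω using hφ _ hω
    _ = A + C * ∫ ω, (Z ω - (k + m)) ^ 2 ∂ν := by
        rw [integral_add i1 i2, integral_add (integrable_const _) i3, integral_const_mul,
          integral_const_mul, integral_sub i4 (integrable_const _),
          h.integral_eq]
        simp
    _ ≤ _ := by gcongr; exact h.integral_sq_le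

/-- Expansion of `1 / z` at the mean `M`: the exact remainder `(z - M) ^ 2 / (M ^ 2 z)` is
controlled by `z ≥ k`. -/
theorem integral_inv_le (h : GainMoments ν Z k m V) (hk : 0 < k) :
    ∫ ω, (Z ω)⁻¹ ∂ν ≤ (k + m)⁻¹ + V / ((k + m) ^ 2 * k) := by
  have hM : 0 < k + m := by linarith [h.nonneg]
  have := h.integral_le_of_le_quadratic (φ := fun z => z⁻¹) (A := (k + m)⁻¹)
    (B := -((k + m) ^ 2)⁻¹) (C := ((k + m) ^ 2 * k)⁻¹) (by positivity) (fun z hz => ?_)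
  · rwa [div_eq_inv_mul]
  · have hz0 : 0 < z := hk.trans_le hz
    set M := k + m
    have e : z⁻¹ = M⁻¹ + -(M ^ 2)⁻¹ * (z - M) + (M ^ 2 * z)⁻¹ * (z - M) ^ 2 := by
      field_simp; ring
    rw [e]
    gcongr

/-- Jensen's inequality by the tangent at the mean; the quadratic coefficient is `0`, so the
variance does not enter. -/
theorem inv_le_integral_inv_add (h : GainMoments ν Z k m V) (hk : 0 < k) {N : ℝ} (hN : 0 ≤ N) :
    (N + (k + m))⁻¹ ≤ ∫ ω, (N + Z ω)⁻¹ ∂ν := by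
  have hM : 0 < k + m := by linarith [h.nonneg]
  have := h.integral_le_of_le_quadratic (φ := fun z => -(N + z)⁻¹) (A := -(N + (k + m))⁻¹)
    (B := ((N + (k + m)) ^ 2)⁻¹) (C := 0) le_rfl (fun z hz => ?_)
  · rw [integral_neg] at this
    linarith
  · have hz0 : 0 < z := hk.trans_le hz
    set M := k + m
    have e : -(N + M)⁻¹ + ((N + M) ^ 2)⁻¹ * (z - M) + 0 * (z - M) ^ 2
        = -(N + z)⁻¹ + (z - M) ^ 2 / ((N + M) ^ 2 * (N + z)) := by
      field_simp; ring
    simp only [e]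
    have : 0 ≤ (z - M) ^ 2 / ((N + M) ^ 2 * (N + z)) := by positivity
    linarith

/-- A second-moment argument: `E[1 - k / Z] ≥ E[Z - k] ^ 2 / E[Z (Z - k)]` by Cauchy–Schwarz, and
the right side is at least `m ^ 2 / Q`. This contraction holds uniformly down to `k = 1`, where
expansion at the mean is too crude. -/
theorem integral_div_le {δ c : ℝ} (h : GainMoments ν Z k m (m + c * k)) (hk : 1 ≤ k) (hδ : 0 < δ)
    (hc : 0 ≤ c) (hm : δ * k ≤ m) :
    ∫ ω, k / Z ω ∂ν ≤ 1 - δ ^ 2 / (δ ^ 2 + 2 * δ + c) := by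
  have hm0 : 0 < m := lt_of_lt_of_le (by positivity) hm
  set Q := (k + m) * m + (m + c * k) with hQ
  have hQ0 : 0 < Q := by positivity
  -- The majorant is `1 - 2 θ (z - k) + θ ^ 2 z (z - k)`, which exceeds `k / z` by `(z - k)(1 - θ z)
  -- ^ 2 / z`; `θ = m / Q` minimises the resulting bound `1 - 2 θ m + θ ^ 2 Q`.
  have := h.integral_le_of_le_quadratic (φ := fun z => k / z)
    (A := 1 - 2 * (m / Q) * m + (m / Q) ^ 2 * (m * (k + m)))
    (B := -2 * (m / Q) + (m / Q) ^ 2 * (k + 2 * m)) (C := (m / Q) ^ 2) (by positivity)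
    (fun z hz => ?_)
  · refine this.trans ?_
    have e : 1 - 2 * (m / Q) * m + (m / Q) ^ 2 * (m * (k + m)) + (m / Q) ^ 2 * (m + c * k)
        = 1 - m ^ 2 / Q := by
      have : (m / Q) ^ 2 * (m * (k + m)) + (m / Q) ^ 2 * (m + c * k) = (m / Q) ^ 2 * Q := by
        rw [hQ]; ring
      rw [add_assoc, this]
      field_simp; ring
    rw [e]
    gcongr 1 - ?_
    rw [div_le_div_iff₀ (by positivity) hQ0, hQ]
    have h1 : δ * (δ * (k * m)) ≤ δ * (m * m) := by
      have := mul_le_mul_of_nonneg_right hm hm0.le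
      exact mul_le_mul_of_nonneg_left (by linarith) hδ.le
    have h2 : δ ^ 2 * m ≤ δ * m ^ 2 := by
      have : δ ≤ m := (le_mul_of_one_le_right hδ.le hk).trans hm
      have := mul_le_mul_of_nonneg_left this (mul_pos hδ hm0).le
      linarith
    have h3 : c * (δ ^ 2 * k) ≤ c * m ^ 2 := by
      gcongr
      have : (δ * k) ^ 2 ≤ m ^ 2 := by gcongr
      nlinarith
    linarith
  · have hz0 : 0 < z := by linarith
    set θ := m / Q
    have e : 1 - 2 * θ * m + θ ^ 2 * (m * (k + m)) + (-2 * θ + θ ^ 2 * (k + 2 * m)) * (z - (k + m))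
        + θ ^ 2 * (z - (k + m)) ^ 2 = k / z + (z - k) * (1 - θ * z) ^ 2 / z := by
      field_simp; ring
    rw [e]
    have : 0 ≤ (z - k) * (1 - θ * z) ^ 2 / z := by
      have := sub_nonneg.2 hz
      positivity
    linarith

theorem measureReal_lt_le (h : GainMoments ν Z k m V) (hZ : Measurable Z) {u y : ℝ} (hu : 0 < u)
    (hy : k + m + u ≤ y) : ν.real {ω | y < Z ω} ≤ V / u ^ 2 := by
  classical
  have := h.integral_le_of_le_quadratic (φ := (Set.Ioi y).indicator 1) (A := 0) (B := 0)
    (C := (u ^ 2)⁻¹) (by positivity) (fun z _ => ?_)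
  · rw [← integral_indicator_one (measurableSet_lt measurable_const hZ)]
    rw [zero_add, ← div_eq_inv_mul] at this
    exact this
  · simp only [Set.indicator, Set.mem_Ioi, Pi.one_apply]
    rw [zero_mul, zero_add, zero_add, inv_mul_eq_div]
    split_ifs with hyz
    · rw [one_le_div (by positivity)]
      gcongr
      linarith
    · positivity

theorem integral_rpow_le (h : GainMoments ν Z k m V) {φ : ℝ → ℝ} (hφ : ∀ z, k ≤ z → 0 ≤ φ z)
    {s : ℝ} (hs₀ : 0 ≤ s) (hs₁ : s ≤ 1) :
    ∫ ω, φ (Z ω) ^ s ∂ν ≤ (∫ ω, φ (Z ω) ∂ν) ^ s := by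
  have := h.isProbabilityMeasure
  refine (Real.concaveOn_rpow hs₀ hs₁).le_map_integral ?_ isClosed_Ici ?_
    (h.integrable_comp φ) (h.integrable_comp fun z => φ z ^ s)
  · exact (Real.continuous_rpow_const hs₀).continuousOn
  · filter_upwards [h.le_ae] with ω hω using hφ _ hω

end GainMoments

namespace HomogeneousRumorProcess

variable {n : ℕ} {Ω : Type*} [MeasurableSpace Ω] {μ : Measure Ω}

theorem gainMoments [IsProbabilityMeasure μ] (P : HomogeneousRumorProcess n μ) (t : ℕ)
    (h : ℕ → Finset (Fin n)) (hpos : μ (P.historyEvent t h) ≠ 0) {v : ℝ} (hv : 0 ≤ v)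
    (hcov : P.covNumber (h t).card ≤ v) :
    GainMoments (μ[| P.historyEvent t h]) (P.count (t + 1)) (h t).card (P.meanGain (h t).card)
      (P.meanGain (h t).card + (n : ℝ) ^ 2 * v) where
  isProbabilityMeasure := cond_isProbabilityMeasure hpos
  integrable_comp φ :=
    have := cond_isProbabilityMeasure hpos
    P.integrable_comp_count (t + 1) φ _
  le_ae := by
    filter_upwards [P.count_ae_eq t h] with ω hω
    rw [← hω]
    exact P.count_mono ω (Nat.le_succ t)
  integral_eq := P.integral_count_succ t h hpos
  integral_sq_le := P.integral_sq_count_succ_sub_le t h hpos hv hcov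

theorem meanGain_nonneg [IsProbabilityMeasure μ] (P : HomogeneousRumorProcess n μ) (t : ℕ)
    (h : ℕ → Finset (Fin n)) (hpos : μ (P.historyEvent t h) ≠ 0) :
    0 ≤ P.meanGain (h t).card :=
  -- The variance is irrelevant here, so any nonnegative bound for the covariance number serves,
  -- such as its absolute value.
  (P.gainMoments t h hpos (abs_nonneg _) (le_abs_self _)).nonneg

/-- The moments of a round in which the covariance number is at most `c k / n ^ 2`. -/
theorem gainMoments_of_le [IsProbabilityMeasure μ] (P : HomogeneousRumorProcess n μ) (t : ℕ)
    (h : ℕ → Finset (Fin n)) (hpos : μ (P.historyEvent t h) ≠ 0) (hn : 0 < n) {c : ℝ} (hc : 0 ≤ c)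
    (hcov : P.covNumber (h t).card ≤ c * ((h t).card / (n : ℝ) ^ 2)) :
    GainMoments (μ[| P.historyEvent t h]) (P.count (t + 1)) (h t).card (P.meanGain (h t).card)
      (P.meanGain (h t).card + c * (h t).card) := by
  convert P.gainMoments t h hpos (by positivity) hcov using 2
  have : (n : ℝ) ≠ 0 := by positivity
  field_simp

end HomogeneousRumorProcess

/-! ### Overshooting -/

namespace HomogeneousRumorProcess

variable {n : ℕ} {Ω : Type*} [MeasurableSpace Ω] {μ : Measure Ω}

/-- If in every round starting with `k < m` nodes the probability of jumping beyond `m'` is at most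
`C` times the expected gain, then the overshooting probability is at most `C n`. -/
theorem measure_overshoot_le [IsProbabilityMeasure μ] (P : HomogeneousRumorProcess n μ)
    {m m' C : ℝ} (hm : 1 < m) (hC : 0 ≤ C)
    (H : ∀ t h, μ (P.historyEvent t h) ≠ 0 → ((h t).card : ℝ) < m →
      (μ[| P.historyEvent t h]).real {ω | m' < P.count (t + 1) ω} ≤ C * P.meanGain (h t).card) :
    μ {ω | ∃ t : ℕ, P.spreadingTime m ω = t ∧ m' < P.count t ω} ≤ ENNReal.ofReal (C * n) := by
  set E : ℕ → Set Ω := fun t => {ω | P.count t ω < m} ∩ {ω | m' < P.count (t + 1) ω}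
  have hE : ∀ t, MeasurableSet (E t) := fun t =>
    (P.measurableSet_count_lt m t).inter (measurableSet_lt measurable_const (P.measurable_count _))
  -- Each round is charged to the increase of `E[I_t]`; these increases telescope, so no bound on
  -- the number of rounds is needed.
  have hstep : ∀ t, μ.real (E t) ≤ C * (∫ ω, P.count (t + 1) ω ∂μ - ∫ ω, P.count t ω ∂μ) := by
    intro t
    have i1 := P.integrable_count (t + 1) μ
    have i2 := P.integrable_count t μ
    rw [← integral_indicator_one (hE t), ← integral_sub i1 i2, ← integral_const_mul]
    refine P.integral_le_of_cond t ((integrable_const 1).indicator (hE t))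
      ((i1.sub i2).const_mul C) fun h hpos => ?_
    have := cond_isProbabilityMeasure hpos
    have hR : ∫ ω, C * (P.count (t + 1) ω - P.count t ω) ∂μ[| P.historyEvent t h]
        = C * P.meanGain (h t).card := by
      rw [integral_const_mul, integral_sub (P.integrable_count _ _) (P.integrable_count _ _),
        P.integral_count_succ t h hpos, integral_congr_ae (P.count_ae_eq t h)]
      simp
    have hL : ∫ ω, (E t).indicator 1 ω ∂μ[| P.historyEvent t h] =
        (μ[| P.historyEvent t h]).real (E t) := integral_indicator_one (hE t)
    rw [hR]
    refine hL.trans_le ?_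
    by_cases hk : ((h t).card : ℝ) < m
    · exact (measureReal_mono Set.inter_subset_right).trans (H t h hpos hk)
    · have h0 : (μ[| P.historyEvent t h]).real (E t) = 0 := by
        rw [measureReal_def, measure_eq_zero_iff_ae_notMem.2, ENNReal.toReal_zero]
        filter_upwards [P.count_ae_eq t h] with ω hω hmem
        exact hk (hω ▸ hmem.1)
      rw [h0]
      exact mul_nonneg hC (P.meanGain_nonneg t h hpos)
  have hsum : ∀ T, ∑ t ∈ Finset.range T, μ.real (E t) ≤ C * n := by
    intro T
    calc _ ≤ ∑ t ∈ Finset.range T, C * (∫ ω, P.count (t + 1) ω ∂μ - ∫ ω, P.count t ω ∂μ) :=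
          Finset.sum_le_sum fun t _ => hstep t
      _ = C * (∫ ω, P.count T ω ∂μ - ∫ ω, P.count 0 ω ∂μ) := by
          rw [← Finset.mul_sum, Finset.sum_range_sub fun t => ∫ ω, P.count t ω ∂μ]
      _ ≤ C * n := by
          have h1 : ∫ ω, P.count T ω ∂μ ≤ ∫ _, (n : ℝ) ∂μ :=
            integral_mono (P.integrable_count T μ) (integrable_const _) (P.count_le T)
          have h2 : 0 ≤ ∫ ω, P.count 0 ω ∂μ :=
            integral_nonneg fun ω => zero_le_one.trans (P.one_le_count 0 ω)
          simp only [integral_const, probReal_univ, smul_eq_mul, one_mul] at h1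
          gcongr
          linarith
  calc _ ≤ μ (⋃ t, E t) := by
        refine measure_mono ?_
        rintro ω ⟨t, ht, hω⟩
        -- Time `0` is excluded since one informed node is fewer than `m`; otherwise the jump
        -- happens in the round that ends at `T`.
        obtain _ | t := t
        · have := (P.spreadingTime_le_iff m ω 0).1 ht.le
          rw [P.count_zero] at this
          linarith
        · refine Set.mem_iUnion.2 ⟨t, ?_, hω⟩
          refine (P.lt_spreadingTime_iff m ω t).1 ?_
          rw [ht]
          exact_mod_cast Nat.lt_succ_self t
    _ ≤ ∑' t, μ (E t) := measure_iUnion_le _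
    _ ≤ ENNReal.ofReal (C * n) := by
        refine ENNReal.tsum_le_of_sum_range_le fun T => ?_
        calc ∑ t ∈ Finset.range T, μ (E t)
            = ENNReal.ofReal (∑ t ∈ Finset.range T, μ.real (E t)) := by
              rw [ENNReal.ofReal_sum_of_nonneg fun _ _ => measureReal_nonneg]
              simp
          _ ≤ _ := ENNReal.ofReal_le_ofReal (hsum T)

end HomogeneousRumorProcess

open HomogeneousRumorProcess

/-- The mean after a round from `k < f n` is at most `k + (n - k) q' ≤ (f + (1 - f) q') n`, a
distance `u n` below `f' n`. The variance is `O(k)`, hence `O(m)` by the lower bound on `p_k`, so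
Chebyshev gives `O(m / n ^ 2)`. -/
theorem overshoot_of_lowerExpGrowth (γ₀ γ₁ a b c f : ℝ) (hγ₀ : 0 < γ₀) (hγ : γ₀ ≤ γ₁)
    (ha : 0 ≤ a) (hb : 0 ≤ b) (hc : 0 ≤ c) (hf₀ : 0 < f) (hf₁ : f < 1)
    (κ q : ℝ) (hκ : 0 < κ) (hq : q < 1) :
      ∃ (f' D : ℝ) (N : ℕ), f < f' ∧ f' < 1 ∧
        ∀ (n : ℕ), N ≤ n →
        ∀ (Ω : Type*) [MeasurableSpace Ω] (μ : Measure Ω) [IsProbabilityMeasure μ]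
          (P : HomogeneousRumorProcess n μ) (γ : ℝ), γ₀ ≤ γ → γ ≤ γ₁ →
          P.LowerExpGrowth γ a b c f →
          (∀ k : ℕ, 1 ≤ k → (k : ℝ) < f * n → κ * (k / n) ≤ P.p k ∧ P.p k ≤ q) →
            μ {ω | ∃ t : ℕ, P.spreadingTime (f * n) ω = t ∧
                f' * n < ((P.informed t ω).card : ℝ)}
              ≤ ENNReal.ofReal (D / n) := by
  obtain ⟨q', hqq', hq'0, hq'1⟩ : ∃ q', q ≤ q' ∧ 0 ≤ q' ∧ q' < 1 :=
    ⟨max q 0, le_max_left _ _, le_max_right _ _, max_lt hq one_pos⟩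
  have hf1 : 0 < 1 - f := by linarith
  -- Half the gap between `f + (1 - f) q'` and `1`, so that `f'` is the midpoint.
  set u := (1 - f) * (1 - q') / 2 with hu
  have hu0 : 0 < u := by have := sub_pos.2 hq'1; positivity
  set Γ := γ₁ * (1 + a + b) with hΓ
  have hΓ0 : 0 < Γ := by have := hγ₀.trans_le hγ; positivity
  refine ⟨f + (1 - f) * q' + u, (Γ + c) / (u ^ 2 * ((1 - f) * κ)), ⌈f⁻¹⌉₊ + 3, ?_, ?_, ?_⟩
  · have : 0 ≤ (1 - f) * q' := by positivity
    linarith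
  · nlinarith
  intro n hn Ω _ μ _ P γ hγ0 hγ1 hP hp
  have hn3 : (3 : ℝ) ≤ n := by exact_mod_cast (by omega : 3 ≤ n)
  have hnf : 1 < f * n := by
    have h1 : f⁻¹ ≤ ⌈f⁻¹⌉₊ := Nat.le_ceil _
    have h2 : ((⌈f⁻¹⌉₊ + 3 : ℕ) : ℝ) ≤ n := by exact_mod_cast hn
    push_cast at h2
    rw [← inv_lt_iff_one_lt_mul₀' hf₀]
    linarith
  have hn0 : (0 : ℝ) < n := by linarith
  have hlog : 1 ≤ Real.log n := by
    rw [Real.le_log_iff_exp_le hn0]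
    linarith [Real.exp_one_lt_d9]
  set C := (Γ + c) / (u ^ 2 * ((1 - f) * κ)) / (n : ℝ) ^ 2 with hC
  have hC0 : 0 ≤ C := by positivity
  have hCn : (Γ + c) / (u ^ 2 * ((1 - f) * κ)) / n = C * n := by
    rw [hC]; field_simp
  rw [hCn]
  refine P.measure_overshoot_le hnf hC0 fun t h hpos hk => ?_
  have hk1 : (1 : ℝ) ≤ (h t).card := by exact_mod_cast P.card_history_pos t h hpos
  obtain ⟨hpu, hcov⟩ := hP _ (P.card_history_pos t h hpos) hk
  obtain ⟨hpl, hpq⟩ := hp _ (P.card_history_pos t h hpos) hk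
  have hM := P.gainMoments_of_le t h hpos (by omega) hc hcov
  have hmG : P.meanGain (h t).card = (n - (h t).card) * P.p (h t).card := rfl
  set k : ℝ := ((h t).card : ℝ)
  set m := P.meanGain (h t).card
  have hnk : 0 ≤ n - k := by nlinarith
  have hkn : k / n ≤ 1 := by rw [div_le_one hn0]; linarith
  have hm_low : (1 - f) * κ * k ≤ m := by
    calc (1 - f) * κ * k = ((1 - f) * n) * (κ * (k / n)) := by field_simp
      _ ≤ (n - k) * P.p (h t).card := by
          gcongr
          linarith
      _ = m := hmG.symm
  have hm_up : m ≤ Γ * k := by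
    calc m = (n - k) * P.p (h t).card := hmG
      _ ≤ n * (γ₁ * (k / n) * (1 + a * 1 + b / 1)) := by
          have h0 : 0 ≤ P.p (h t).card := le_trans (by positivity) hpl
          have hγ0' : 0 ≤ γ := by linarith
          have hγ1' : 0 ≤ γ₁ := by linarith
          gcongr
          · linarith
          · refine hpu.trans ?_
            gcongr
      _ = Γ * k := by rw [hΓ]; field_simp
  have hmq : k + m + u * n ≤ (f + (1 - f) * q' + u) * n := by
    have : m ≤ (n - k) * q' := by
      rw [hmG]; gcongr; exact hpq.trans hqq'
    nlinarith
  refine (hM.measureReal_lt_le (P.measurable_count _) (by positivity) hmq).trans ?_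
  rw [div_le_iff₀ (by positivity)]
  calc m + c * k ≤ (Γ + c) * k := by linarith
    _ = (Γ + c) / ((1 - f) * κ) * ((1 - f) * κ * k) := by field_simp
    _ ≤ (Γ + c) / ((1 - f) * κ) * m := by gcongr
    _ = C * m * (u * n) ^ 2 := by rw [hC]; field_simp

/-! ### Lower bounds for the spreading time: the concave potential -/

theorem sum_range_mul_exp_neg_le {A α : ℝ} (hA : 0 ≤ A) (hα : 0 < α) (M : ℕ) :
    ∑ j ∈ Finset.range M, A * Real.exp (-α * j) ≤ A * (1 - Real.exp (-α))⁻¹ := by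
  have h1 : Real.exp (-α) < 1 := by
    rw [← Real.exp_zero]; exact Real.exp_lt_exp.2 (by linarith)
  rw [← Finset.mul_sum, ← tsum_geometric_of_lt_one (Real.exp_pos _).le h1]
  gcongr
  have e : ∀ j : ℕ, Real.exp (-α * j) = Real.exp (-α) ^ j := fun j => by
    rw [← Real.exp_nat_mul]; ring_nf
  simp_rw [e]
  exact (summable_geometric_of_lt_one (Real.exp_pos _).le h1).sum_le_tsum _
    fun _ _ => by positivity

namespace HomogeneousRumorProcess

variable {n : ℕ} {Ω : Type*} [MeasurableSpace Ω] {μ : Measure Ω}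

/-- A lower tail bound for the spreading time from bounds for the numbers of informed nodes. -/
theorem measure_spreadingTime_le_sub (P : HomogeneousRumorProcess n μ) {m L B : ℝ} {r : ℕ}
    (H : ∀ t : ℕ, (t : ℝ) ≤ L - r → μ {ω | m ≤ P.count t ω} ≤ ENNReal.ofReal B) :
    μ {ω | ∃ t : ℕ, P.spreadingTime m ω = t ∧ (t : ℝ) ≤ L - r} ≤ ENNReal.ofReal B := by
  by_cases hL : 0 ≤ L - r
  · refine le_trans (measure_mono ?_) (H ⌊L - r⌋₊ (Nat.floor_le hL))
    rintro ω ⟨t, ht, htL⟩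
    exact ((P.spreadingTime_le_iff m ω t).1 ht.le).trans (P.count_mono ω (Nat.le_floor htL))
  · have : {ω | ∃ t : ℕ, P.spreadingTime m ω = t ∧ (t : ℝ) ≤ L - r} = ∅ := by
      refine Set.eq_empty_of_forall_notMem ?_
      rintro ω ⟨t, -, htL⟩
      exact hL ((Nat.cast_nonneg t).trans htL)
    rw [this, measure_empty]
    exact zero_le

/-- A lower bound for the expected spreading time from lower tail bounds. -/
theorem ofReal_sub_le_lintegral_spreadingTime [IsProbabilityMeasure μ]
    (P : HomogeneousRumorProcess n μ) {m L A α : ℝ} (hA : 0 ≤ A) (hα : 0 < α) (hL : 0 ≤ L)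
    (H : ∀ t r : ℕ, (t : ℝ) ≤ L - r →
      μ {ω | m ≤ P.count t ω} ≤ ENNReal.ofReal (A * Real.exp (-α * r))) :
    ENNReal.ofReal (L - (1 + A * (1 - Real.exp (-α))⁻¹))
      ≤ ∫⁻ ω, (P.spreadingTime m ω : ℝ≥0∞) ∂μ := by
  rw [P.lintegral_spreadingTime]
  set M := ⌊L⌋₊
  have hML : (M : ℝ) ≤ L := Nat.floor_le hL
  have hLM : L < M + 1 := Nat.lt_floor_add_one L
  -- Round `t` has slack `M - 1 - t` before `⌊L⌋ - 1`; summed in reverse order, the errors form a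
  -- geometric series bounded independently of `L`.
  have hterm : ∀ t ∈ Finset.range M, 1 - A * Real.exp (-α * ((M - 1 - t : ℕ) : ℝ))
      ≤ μ.real {ω | P.count t ω < m} := by
    intro t ht
    rw [Finset.mem_range] at ht
    have h1 := H t (M - 1 - t) (by
      have : ((M - 1 - t : ℕ) : ℝ) + t + 1 = M := by
        exact_mod_cast (by omega : M - 1 - t + t + 1 = M)
      linarith)
    have h2 : μ.real {ω | m ≤ P.count t ω} ≤ A * Real.exp (-α * ((M - 1 - t : ℕ) : ℝ)) :=
      ENNReal.toReal_le_of_le_ofReal (by positivity) h1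
    have h3 := probReal_compl_eq_one_sub (μ := μ) (P.measurableSet_count_lt m t)
    have h4 : {ω | P.count t ω < m}ᶜ = {ω | m ≤ P.count t ω} := by
      ext ω; simp
    rw [h4] at h3
    linarith
  calc ENNReal.ofReal (L - (1 + A * (1 - Real.exp (-α))⁻¹))
      ≤ ENNReal.ofReal (∑ t ∈ Finset.range M, μ.real {ω | P.count t ω < m}) := by
        refine ENNReal.ofReal_le_ofReal (le_trans ?_ (Finset.sum_le_sum hterm))
        rw [Finset.sum_sub_distrib,
          Finset.sum_range_reflect (fun j : ℕ => A * Real.exp (-α * (j : ℝ))) M]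
        have := sum_range_mul_exp_neg_le hA hα M
        simp only [Finset.sum_const, Finset.card_range, nsmul_eq_mul, mul_one]
        linarith
    _ = ∑ t ∈ Finset.range M, μ {ω | P.count t ω < m} := by
        rw [ENNReal.ofReal_sum_of_nonneg fun _ _ => measureReal_nonneg]
        simp
    _ ≤ _ := ENNReal.sum_le_tsum _

/-- If the mean of the concave potential `N y / (N + y)`, truncated at `y = θ`, grows in each round
by a factor of at most `Λ`, then reaching `θ` within few rounds is unlikely. -/
theorem measureReal_le_count_le [IsProbabilityMeasure μ]
    (P : HomogeneousRumorProcess n μ) {N θ Λ : ℝ} (hθ : 0 < θ) (hθN : θ ≤ N) (hΛ : 1 ≤ Λ)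
    (H : ∀ t h, μ (P.historyEvent t h) ≠ 0 → ((h t).card : ℝ) < θ →
      N * ((h t).card + P.meanGain (h t).card) / (N + ((h t).card + P.meanGain (h t).card))
        ≤ Λ * (N * (h t).card / (N + (h t).card))) (t : ℕ) :
    μ.real {ω | θ ≤ P.count t ω} ≤ 2 * Λ ^ t / θ := by
  have hN : 0 < N := hθ.trans_le hθN
  set F : ℝ → ℝ := fun y => N * y / (N + y) with hF
  have hFe : ∀ y, 0 ≤ y → F y = N - N ^ 2 * (N + y)⁻¹ := fun y hy => by
    have : 0 < N + y := by linarith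
    simp only [hF]; field_simp; ring
  have hFmono : ∀ y z, 0 ≤ y → y ≤ z → F y ≤ F z := fun y z hy hyz => by
    rw [hFe y hy, hFe z (hy.trans hyz)]
    have : 0 < N + y := by linarith
    gcongr
  have hF0 : ∀ y, 0 ≤ y → 0 ≤ F y := fun y hy => by simp only [hF]; positivity
  -- The growth hypothesis is available only below `θ`; from `θ` on, the capped potential cannot
  -- grow.
  set G : ℝ → ℝ := fun y => min (F y) (F θ) with hG
  have hstep : ∀ t, ∫ ω, G (P.count (t + 1) ω) ∂μ ≤ Λ * ∫ ω, G (P.count t ω) ∂μ := by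
    intro t
    rw [← integral_const_mul]
    refine P.integral_le_of_cond t (P.integrable_comp_count _ G _)
      ((P.integrable_comp_count _ G _).const_mul Λ) fun h hpos => ?_
    have := cond_isProbabilityMeasure hpos
    have hM := P.gainMoments t h hpos (abs_nonneg _) (le_abs_self _)
    have hk1 : (1 : ℝ) ≤ (h t).card := by exact_mod_cast P.card_history_pos t h hpos
    have hR : ∫ ω, Λ * G (P.count t ω) ∂μ[| P.historyEvent t h] = Λ * G (h t).card := by
      rw [integral_const_mul]
      have : ∀ᵐ ω ∂μ[| P.historyEvent t h], G (P.count t ω) = G (h t).card := by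
        filter_upwards [P.count_ae_eq t h] with ω hω
        rw [hω]
      rw [integral_congr_ae this]
      simp
    rw [hR]
    have hFk0 := hF0 (h t).card (by linarith)
    have hFθ0 := hF0 θ hθ.le
    by_cases hk : ((h t).card : ℝ) < θ
    · have hGk : G (h t).card = F (h t).card :=
        min_eq_left (hFmono _ _ (by linarith) hk.le)
      rw [hGk]
      refine le_trans ?_ (H t h hpos hk)
      have hinv := hM.inv_le_integral_inv_add (by linarith) hN.le
      have i1 := hM.integrable_comp fun z => (N + z)⁻¹
      calc ∫ ω, G (P.count (t + 1) ω) ∂μ[| P.historyEvent t h]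
          ≤ ∫ ω, (N - N ^ 2 * (N + P.count (t + 1) ω)⁻¹) ∂μ[| P.historyEvent t h] := by
            refine integral_mono_ae (hM.integrable_comp G)
              ((integrable_const _).sub (i1.const_mul _)) ?_
            filter_upwards [hM.le_ae] with ω hω
            rw [← hFe _ (by linarith)]
            exact min_le_left _ _
        _ = N - N ^ 2 * ∫ ω, (N + P.count (t + 1) ω)⁻¹ ∂μ[| P.historyEvent t h] := by
            rw [integral_sub (integrable_const _) (i1.const_mul _), integral_const_mul]
            simp
        _ ≤ N - N ^ 2 * (N + ((h t).card + P.meanGain (h t).card))⁻¹ := by gcongr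
        _ = _ := (hFe _ (by linarith [hM.nonneg])).symm
    · rw [not_lt] at hk
      have hGk : G (h t).card = F θ := min_eq_right (hFmono _ _ hθ.le hk)
      rw [hGk]
      calc _ ≤ ∫ _, F θ ∂μ[| P.historyEvent t h] :=
            integral_mono (hM.integrable_comp G) (integrable_const _) fun ω => min_le_right _ _
        _ = F θ := by simp
        _ ≤ Λ * F θ := le_mul_of_one_le_left hFθ0 hΛ
  have hind : ∀ t, ∫ ω, G (P.count t ω) ∂μ ≤ Λ ^ t := by
    intro t
    induction t with
    | zero =>
      simp only [P.count_zero, integral_const, probReal_univ, smul_eq_mul, one_mul, pow_zero]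
      refine (min_le_left _ _).trans ?_
      simp only [hF]
      rw [div_le_one (by linarith)]
      linarith
    | succ t ih =>
      calc _ ≤ _ := hstep t
        _ ≤ Λ * Λ ^ t := by gcongr
        _ = _ := by ring
  -- By `θ ≤ N` the potential is still comparable to `y` at `θ`, so Markov's inequality loses only a
  -- factor `2`.
  have hFθ : θ / 2 ≤ F θ := by
    simp only [hF]
    rw [div_le_div_iff₀ two_pos (by linarith)]
    nlinarith
  have hFθpos : 0 < F θ := lt_of_lt_of_le (by positivity) hFθ
  have hmarkov := mul_meas_ge_le_integral_of_nonneg (μ := μ) (f := fun ω => G (P.count t ω))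
    (Filter.Eventually.of_forall fun ω =>
      le_min (hF0 _ (by linarith [P.one_le_count t ω])) hFθpos.le)
    (P.integrable_comp_count t G μ) (F θ)
  have hsub : μ.real {ω | θ ≤ P.count t ω} ≤ μ.real {ω | F θ ≤ G (P.count t ω)} :=
    measureReal_mono fun ω hω => le_min (hFmono _ _ hθ.le hω) le_rfl
  rw [le_div_iff₀ hθ]
  have : μ.real {ω | θ ≤ P.count t ω} * (θ / 2) ≤ Λ ^ t := by
    calc _ ≤ μ.real {ω | F θ ≤ G (P.count t ω)} * F θ := by gcongr
      _ ≤ _ := by rw [mul_comm]; exact hmarkov.trans (hind t)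
  linarith

/-- The growth of the potential `N y / (N + y)` with `N = n / (2 a + 1)`. -/
theorem concave_potential_growth {n k m γ a w : ℝ} (hn : 0 < n) (hk : 0 < k) (hm : 0 ≤ m)
    (hγ : 0 ≤ γ) (ha : 0 ≤ a) (hw : 0 ≤ w) (hkn : k ≤ n / (2 * a + 1))
    (hmle : m ≤ γ * k * (1 + a * (k / n) + w)) :
    n / (2 * a + 1) * (k + m) / (n / (2 * a + 1) + (k + m))
      ≤ (1 + γ) * (1 + w) * (n / (2 * a + 1) * k / (n / (2 * a + 1) + k)) := by
  set N := n / (2 * a + 1) with hN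
  have hη : 0 < 2 * a + 1 := by linarith
  have hN0 : 0 < N := by positivity
  set x := k / n
  have hx : (2 * a + 1) * x * N = k := by simp only [x, hN]; field_simp
  have hx0 : 0 ≤ x := by positivity
  have hηx : (2 * a + 1) * x ≤ 1 := by
    by_contra hcon
    nlinarith
  rw [← mul_div_assoc, div_le_div_iff₀ (by positivity) (by positivity)]
  -- With `ρ = 1 + γ (1 + a x + w)` and `y = k / N = (2 a + 1) x ≤ 1` this reads `ρ (1 + y) ≤ (1 +
  -- γ)(1 + w)(1 + ρ y)`. The acceleration contributes `γ a x (1 + y) ≤ γ y`, and the flattening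
  -- gives back at least `(ρ - 1) y ≥ γ y`; this fixes `2 a + 1`.
  have key : (1 + γ * (1 + a * x + w)) * (N + k)
      ≤ (1 + γ) * (1 + w) * (N + k * (1 + γ * (1 + a * x + w))) := by
    rw [← hx]
    have h1 : γ * a * x * (1 + (2 * a + 1) * x) ≤ γ * ((2 * a + 1) * x) := by
      have : a * (1 + (2 * a + 1) * x) ≤ 2 * a + 1 := by nlinarith
      have := mul_le_mul_of_nonneg_left this (mul_nonneg hγ hx0)
      linarith
    have h2 : (1 + γ * (1 + a * x + w)) * (1 + (2 * a + 1) * x)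
        ≤ (1 + γ) * (1 + w) * (1 + (2 * a + 1) * x * (1 + γ * (1 + a * x + w))) := by
      set y := (2 * a + 1) * x
      have hy : 0 ≤ y := by positivity
      set ρ := 1 + γ * (1 + a * x + w) with hρ
      have hax : 0 ≤ γ * (a * x) := by positivity
      have hγw : 0 ≤ γ * w := by positivity
      have h3 : γ ≤ ρ - 1 := by rw [hρ]; linarith
      have h4 : γ * y ≤ (ρ - 1) * y := by gcongr
      have h5 : (1 + γ + γ * w) * (1 + y * ρ) ≤ (1 + γ) * (1 + w) * (1 + y * ρ) := by
        have : 0 ≤ 1 + y * ρ := by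
          have : 0 ≤ ρ := by linarith
          positivity
        refine mul_le_mul_of_nonneg_right ?_ this
        nlinarith
      have h6 : 0 ≤ (γ + γ * w) * ((ρ - 1) * y) := by
        have : 0 ≤ ρ - 1 := hγ.trans h3
        positivity
      refine le_trans ?_ h5
      have h7 : ρ * (1 + y) = (1 + γ + γ * w) * (1 + y) + γ * a * x * (1 + y) := by
        rw [hρ]; ring
      rw [h7]
      linarith
    have := mul_le_mul_of_nonneg_left h2 hN0.le
    linarith
  have hρ0 : 0 ≤ γ * (1 + a * x + w) := by positivity
  -- The potential is increasing, so `k + m` may be replaced by its upper bound `ρ k`.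
  have hmono : (k + m) * (N + k * (1 + γ * (1 + a * x + w)))
      ≤ k * (1 + γ * (1 + a * x + w)) * (N + (k + m)) := by
    nlinarith
  have hpos : 0 < N + k * (1 + γ * (1 + a * x + w)) := by positivity
  have hkm : 0 < N + (k + m) := by positivity
  have h8 : (k + m) * (N + k) * (N + k * (1 + γ * (1 + a * x + w)))
      ≤ (1 + γ) * (1 + w) * k * (N + (k + m)) * (N + k * (1 + γ * (1 + a * x + w))) := by
    calc _ = (k + m) * (N + k * (1 + γ * (1 + a * x + w))) * (N + k) := by ring
      _ ≤ k * (1 + γ * (1 + a * x + w)) * (N + (k + m)) * (N + k) := by gcongr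
      _ = k * (N + (k + m)) * ((1 + γ * (1 + a * x + w)) * (N + k)) := by ring
      _ ≤ k * (N + (k + m)) *
          ((1 + γ) * (1 + w) * (N + k * (1 + γ * (1 + a * x + w)))) := by gcongr
      _ = _ := by ring
  have h9 := le_of_mul_le_mul_right h8 hpos
  calc N * (k + m) * (N + k) = N * ((k + m) * (N + k)) := by ring
    _ ≤ N * ((1 + γ) * (1 + w) * k * (N + (k + m))) := by gcongr
    _ = _ := by ring

end HomogeneousRumorProcess

/-- Reaching `f n` requires reaching `ε n`, whose probability within `t ≤ L - r` rounds is at most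
`(2 / ε)(1 + w) ^ t (1 + γ) ^ t / n`. Here `(1 + γ) ^ t / n ≤ (1 + γ) ^ (-r)` and `(1 + w) ^ t ≤ exp
(w L)` is bounded. -/
theorem spreadingTime_of_lowerExpGrowth (γ₀ γ₁ a b c f : ℝ) (hγ₀ : 0 < γ₀)
    (ha : 0 ≤ a) (hb : 0 ≤ b) (hf₀ : 0 < f) (hf₁ : f < 1) :
    ∃ (C A' α' : ℝ) (N : ℕ), 0 < A' ∧ 0 < α' ∧
        ∀ (n : ℕ), N ≤ n →
        ∀ (Ω : Type*) [MeasurableSpace Ω] (μ : Measure Ω) [IsProbabilityMeasure μ]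
          (P : HomogeneousRumorProcess n μ) (γ : ℝ), γ₀ ≤ γ → γ ≤ γ₁ →
          P.LowerExpGrowth γ a b c f →
            ENNReal.ofReal (Real.logb (1 + γ) n - C)
                ≤ ∫⁻ ω, (P.spreadingTime (f * n) ω : ℝ≥0∞) ∂μ ∧
            ∀ r : ℕ,
              μ {ω | ∃ t : ℕ, P.spreadingTime (f * n) ω = t ∧ (t : ℝ) ≤ Real.logb (1 + γ) n - r}
                ≤ ENNReal.ofReal (A' * Real.exp (-α' * r)) := by
  have hη : 0 < 2 * a + 1 := by linarith
  obtain ⟨ε, hε0, hεf, hεη⟩ : ∃ ε, 0 < ε ∧ ε ≤ f ∧ ε ≤ 1 / (2 * a + 1) :=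
    ⟨min f (1 / (2 * a + 1)), lt_min hf₀ (by positivity), min_le_left _ _, min_le_right _ _⟩
  set α := Real.log (1 + γ₀) with hα
  have hα0 : 0 < α := Real.log_pos (by linarith)
  set A := 2 / ε * Real.exp (b / α) with hA
  have hA0 : 0 < A := by positivity
  refine ⟨1 + A * (1 - Real.exp (-α))⁻¹, A, α, 3, hA0, hα0, ?_⟩
  intro n hn Ω _ μ _ P γ hγ0 hγ1 hP
  have hn3 : (3 : ℝ) ≤ n := by exact_mod_cast hn
  have hn0 : (0 : ℝ) < n := by linarith
  have hlog : 0 < Real.log n := Real.log_pos (by linarith)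
  have hγpos : 0 < γ := by linarith
  have hlogγ : α ≤ Real.log (1 + γ) := Real.log_le_log (by linarith) (by linarith)
  set w := b / Real.log n with hw
  have hw0 : 0 ≤ w := by positivity
  set L := Real.logb (1 + γ) n with hL
  have hL0 : 0 ≤ L := Real.logb_nonneg (by linarith) (by linarith)
  have hwL : w * L ≤ b / α := by
    have : w * L = b / Real.log (1 + γ) := by
      rw [hw, hL, Real.logb]; field_simp
    rw [this]
    gcongr
  have hmain : ∀ t : ℕ, μ.real {ω | ε * n ≤ P.count t ω}
      ≤ 2 * ((1 + γ) * (1 + w)) ^ t / (ε * n) := by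
    intro t
    have hεn : ε * n ≤ n / (2 * a + 1) := by
      calc ε * n ≤ 1 / (2 * a + 1) * n := by gcongr
        _ = _ := by ring
    refine P.measureReal_le_count_le (by positivity) hεn (by nlinarith [mul_nonneg hγpos.le hw0])
      (fun t h hpos hk => ?_) t
    have hk1 : (1 : ℝ) ≤ (h t).card := by exact_mod_cast P.card_history_pos t h hpos
    have hkf : ((h t).card : ℝ) < f * n := hk.trans_le (by gcongr)
    obtain ⟨hpu, -⟩ := hP _ (P.card_history_pos t h hpos) hkf
    refine concave_potential_growth hn0 (by linarith) (P.meanGain_nonneg t h hpos) hγpos.le ha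
      hw0 (hk.le.trans hεn) ?_
    have hnk : 0 ≤ (n : ℝ) - (h t).card := sub_nonneg.2 (card_history_le t h)
    calc P.meanGain (h t).card = (n - (h t).card) * P.p (h t).card := rfl
      _ ≤ (n - (h t).card) * (γ * ((h t).card / n) * (1 + a * ((h t).card / n) + w)) := by gcongr
      _ ≤ n * (γ * ((h t).card / n) * (1 + a * ((h t).card / n) + w)) := by
          gcongr
          linarith
      _ = _ := by field_simp
  have htail : ∀ t r : ℕ, (t : ℝ) ≤ L - r →
      μ {ω | f * n ≤ P.count t ω} ≤ ENNReal.ofReal (A * Real.exp (-α * r)) := by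
    intro t r htr
    rw [← ofReal_measureReal]
    refine ENNReal.ofReal_le_ofReal ?_
    have hsub : {ω | f * n ≤ P.count t ω} ⊆ {ω | ε * n ≤ P.count t ω} := fun ω hω =>
      le_trans (by gcongr : ε * n ≤ f * n) hω
    calc μ.real {ω | f * n ≤ P.count t ω} ≤ μ.real {ω | ε * n ≤ P.count t ω} :=
          measureReal_mono hsub
      _ ≤ _ := hmain t
      _ = 2 / ε * ((1 + w) ^ t * ((1 + γ) ^ t / n)) := by rw [mul_pow]; field_simp
      _ ≤ 2 / ε * (Real.exp (b / α) * Real.exp (-α * r)) := by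
          have h1 : (1 + w) ^ t ≤ Real.exp (b / α) := by
            calc (1 + w) ^ t ≤ Real.exp w ^ t := by
                  gcongr
                  linarith [Real.add_one_le_exp w]
              _ = Real.exp (w * t) := by rw [← Real.exp_nat_mul, mul_comm]
              _ ≤ _ := by
                  refine Real.exp_le_exp.2 (le_trans ?_ hwL)
                  gcongr
                  linarith [(Nat.cast_nonneg r : (0 : ℝ) ≤ r)]
          have h2 : (1 + γ) ^ t / n ≤ Real.exp (-α * r) := by
            rw [div_le_iff₀ hn0, ← Real.rpow_natCast]
            calc (1 + γ) ^ (t : ℝ) ≤ (1 + γ) ^ (L - r) :=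
                  Real.rpow_le_rpow_of_exponent_le (by linarith) htr
              _ = Real.exp (-Real.log (1 + γ) * r) * n := by
                  rw [sub_eq_add_neg, Real.rpow_add (by linarith), hL,
                    Real.rpow_logb (by linarith) (by linarith) hn0,
                    Real.rpow_def_of_pos (by linarith)]
                  ring_nf
              _ ≤ _ := by gcongr
          gcongr
      _ = A * Real.exp (-α * r) := by rw [hA]; ring
  exact ⟨P.ofReal_sub_le_lintegral_spreadingTime hA0.le hα0 hL0 htail,
    fun r => P.measure_spreadingTime_le_sub fun t ht => htail t r ht⟩

/-! ### Upper bounds for the spreading time: the convex potential -/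

namespace HomogeneousRumorProcess

variable {n : ℕ} {Ω : Type*} [MeasurableSpace Ω] {μ : Measure Ω}

/-- An upper tail bound for the spreading time from bounds for the numbers of informed nodes. -/
theorem measure_add_le_spreadingTime (P : HomogeneousRumorProcess n μ) {m L B : ℝ} {r : ℕ}
    (hL : 0 < L) (H : ∀ t : ℕ, L + r - 1 ≤ t → μ {ω | P.count t ω < m} ≤ ENNReal.ofReal B) :
    μ {ω | ∀ t : ℕ, P.spreadingTime m ω = t → L + r ≤ t} ≤ ENNReal.ofReal B := by
  have hLr : 0 < L + r := by positivity
  have hpos : 0 < ⌈L + r⌉₊ := Nat.ceil_pos.2 hLr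
  have hcast : ((⌈L + r⌉₊ - 1 : ℕ) : ℝ) = ⌈L + r⌉₊ - 1 := by
    rw [Nat.cast_sub hpos, Nat.cast_one]
  have h1 : L + r ≤ ⌈L + r⌉₊ := Nat.le_ceil _
  have h2 : (⌈L + r⌉₊ : ℝ) < L + r + 1 := Nat.ceil_lt_add_one hLr.le
  -- The last round before time `L + r`; it may precede `L + r` by up to one round, whence the `- 1`
  -- in the hypothesis.
  refine le_trans (measure_mono fun ω hω => ?_) (H (⌈L + r⌉₊ - 1) (by rw [hcast]; linarith))
  by_contra hcon
  have hle := (P.spreadingTime_le_iff m ω _).2 (not_lt.1 hcon)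
  obtain ⟨s, hs⟩ := ENat.ne_top_iff_exists.1 (ne_top_of_le_ne_top (ENat.natCast_ne_top _) hle)
  have h3 := hω s hs.symm
  rw [← hs] at hle
  have h4 : s ≤ ⌈L + r⌉₊ - 1 := by exact_mod_cast hle
  have h5 : (s : ℝ) ≤ ((⌈L + r⌉₊ - 1 : ℕ) : ℝ) := by exact_mod_cast h4
  rw [hcast] at h5
  linarith

/-- An upper bound for the expected spreading time from upper tail bounds. -/
theorem lintegral_spreadingTime_le [IsProbabilityMeasure μ]
    (P : HomogeneousRumorProcess n μ) {m L A α : ℝ} (hA : 0 ≤ A) (hα : 0 < α) (hL : 0 ≤ L)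
    (H : ∀ t r : ℕ, L + r - 1 ≤ t →
      μ {ω | P.count t ω < m} ≤ ENNReal.ofReal (A * Real.exp (-α * r))) :
    ∫⁻ ω, (P.spreadingTime m ω : ℝ≥0∞) ∂μ
      ≤ ENNReal.ofReal (L + (1 + A * (1 - Real.exp (-α))⁻¹)) := by
  rw [P.lintegral_spreadingTime]
  set M := ⌈L⌉₊
  have hLM : L ≤ M := Nat.le_ceil _
  have hML : (M : ℝ) < L + 1 := Nat.ceil_lt_add_one hL
  refine ENNReal.tsum_le_of_sum_range_le fun T => ?_
  calc ∑ t ∈ Finset.range T, μ {ω | P.count t ω < m}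
      ≤ ∑ t ∈ Finset.range (M + T), μ {ω | P.count t ω < m} :=
        Finset.sum_le_sum_of_subset (Finset.range_mono (by omega))
    _ = ENNReal.ofReal (∑ t ∈ Finset.range (M + T), μ.real {ω | P.count t ω < m}) := by
        rw [ENNReal.ofReal_sum_of_nonneg fun _ _ => measureReal_nonneg]
        simp
    _ ≤ _ := by
        refine ENNReal.ofReal_le_ofReal ?_
        rw [Finset.sum_range_add]
        have h1 : ∑ t ∈ Finset.range M, μ.real {ω | P.count t ω < m} ≤ M := by
          calc _ ≤ ∑ t ∈ Finset.range M, (1 : ℝ) :=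
                Finset.sum_le_sum fun _ _ => measureReal_le_one
            _ = M := by simp
        have h2 : ∑ r ∈ Finset.range T, μ.real {ω | P.count (M + r) ω < m}
            ≤ A * (1 - Real.exp (-α))⁻¹ := by
          refine le_trans (Finset.sum_le_sum fun r _ => ?_) (sum_range_mul_exp_neg_le hA hα T)
          refine ENNReal.toReal_le_of_le_ofReal (by positivity) (H (M + r) r ?_)
          push_cast
          linarith
        linarith

/-- A potential which in every round starting below `θ` decreases in mean by the factor `Λ`
decreases geometrically in mean, as long as it is counted below `θ` only. -/
theorem integral_indicator_potential_le [IsProbabilityMeasure μ]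
    (P : HomogeneousRumorProcess n μ) {θ Λ : ℝ} {g : ℝ → ℝ} (hg : ∀ y, 1 ≤ y → 0 ≤ g y)
    (hΛ : 0 ≤ Λ)
    (H : ∀ t h, μ (P.historyEvent t h) ≠ 0 → ((h t).card : ℝ) < θ →
      ∫ ω, g (P.count (t + 1) ω) ∂μ[| P.historyEvent t h] ≤ Λ * g (h t).card) (t₀ t : ℕ) :
    ∫ ω, (Set.Iio θ).indicator g (P.count (t₀ + t) ω) ∂μ
      ≤ Λ ^ t * ∫ ω, (Set.Iio θ).indicator g (P.count t₀ ω) ∂μ := by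
  have hstep : ∀ t, ∫ ω, (Set.Iio θ).indicator g (P.count (t + 1) ω) ∂μ
      ≤ Λ * ∫ ω, (Set.Iio θ).indicator g (P.count t ω) ∂μ := by
    intro t
    rw [← integral_const_mul]
    refine P.integral_le_of_cond t (P.integrable_comp_count _ _ _)
      ((P.integrable_comp_count _ _ _).const_mul Λ) fun h hpos => ?_
    have := cond_isProbabilityMeasure hpos
    have hR : ∫ ω, Λ * (Set.Iio θ).indicator g (P.count t ω) ∂μ[| P.historyEvent t h]
        = Λ * (Set.Iio θ).indicator g (h t).card := by
      rw [integral_const_mul]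
      have : ∀ᵐ ω ∂μ[| P.historyEvent t h], (Set.Iio θ).indicator g (P.count t ω)
          = (Set.Iio θ).indicator g (h t).card := by
        filter_upwards [P.count_ae_eq t h] with ω hω
        rw [hω]
      rw [integral_congr_ae this]
      simp
    rw [hR]
    by_cases hk : ((h t).card : ℝ) < θ
    · rw [Set.indicator_of_mem (show ((h t).card : ℝ) ∈ Set.Iio θ from hk)]
      refine le_trans (integral_mono (P.integrable_comp_count _ _ _)
        (P.integrable_comp_count _ g _) fun ω => ?_) (H t h hpos hk)
      exact Set.indicator_le_self' (fun _ _ => hg _ (P.one_le_count _ ω)) _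
    -- Informed nodes stay informed, so the potential remains `0` once `θ` is reached.
    · rw [Set.indicator_of_notMem (show ((h t).card : ℝ) ∉ Set.Iio θ from hk), mul_zero]
      have : ∀ᵐ ω ∂μ[| P.historyEvent t h],
          (Set.Iio θ).indicator g (P.count (t + 1) ω) = 0 := by
        filter_upwards [P.count_ae_eq t h] with ω hω
        refine Set.indicator_of_notMem (fun hmem => hk ?_) _
        rw [← hω]
        exact (P.count_mono ω (Nat.le_succ t)).trans_lt hmem
      rw [integral_congr_ae this, integral_zero]
  induction t with
  | zero => simp
  | succ t ih =>
    calc _ ≤ _ := hstep (t₀ + t)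
      _ ≤ Λ * (Λ ^ t * ∫ ω, (Set.Iio θ).indicator g (P.count t₀ ω) ∂μ) := by gcongr
      _ = _ := by ring

end HomogeneousRumorProcess

/-- The potential `1 / y - 1 / (N + y) = N / (y (N + y))` decreases by the full growth factor
although the growth is slowed down near `n`. -/
theorem convex_potential_decay {n k m γ A w : ℝ} (hn : 0 < n) (hk : 0 < k)
    (hγ : 0 ≤ γ) (hA : 1 ≤ A) (hw : 0 ≤ w) (hw' : w ≤ 1 / 4) (hkn : k ≤ n / (4 * A))
    (hmle : γ * k * (1 - A * (k / n) - w) ≤ m) :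
    n / (4 * A) / ((k + m) * (n / (4 * A) + (k + m)))
      ≤ ((1 + γ) * (1 - w))⁻¹ * (n / (4 * A) / (k * (n / (4 * A) + k))) := by
  have hA0 : 0 < A := by linarith
  set N := n / (4 * A) with hN
  have hN0 : 0 < N := by positivity
  set x := k / n
  have hx : 4 * (A * x) * N = k := by simp only [x, hN]; field_simp
  have hx0 : 0 ≤ A * x := by positivity
  have hηx : 4 * (A * x) ≤ 1 := by
    by_contra hcon
    nlinarith
  set y := A * x
  set ρ := 1 + γ * (1 - y - w) with hρ
  have hρ1 : γ / 2 ≤ ρ - 1 := by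
    have : γ * (1 / 2) ≤ γ * (1 - y - w) := by gcongr; linarith
    rw [hρ]; linarith
  have hρ0 : 1 ≤ ρ := by linarith
  have hkm : ρ * k ≤ k + m := by rw [hρ]; linarith
  have hρk : 0 < ρ * k := by positivity
  have hkm0 : 0 < k + m := hρk.trans_le hkm
  have h1w : 0 < (1 + γ) * (1 - w) := mul_pos (by linarith) (by linarith)
  -- Here `4 y = k / N`. The slowdown costs `γ y (1 + 4 y) ≤ 2 γ y`, and the steepness gains at
  -- least `4 y (ρ - 1) ≥ 2 γ y`; this balance explains the `4` in `N`.
  have key : (1 + γ) * (1 - w) * (1 + 4 * y) ≤ ρ * (1 + 4 * y * ρ) := by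
    have h1 : (1 + γ) * (1 - w) * (1 + 4 * y) ≤ (1 + γ - γ * w) * (1 + 4 * y) := by
      gcongr
      nlinarith
    have h2 : ρ * (1 + 4 * y * ρ)
        = (1 + γ - γ * w) * (1 + 4 * y) - γ * y * (1 + 4 * y) + ρ * (4 * y * (ρ - 1)) := by
      rw [hρ]; ring
    have h3 : 4 * y * (γ / 2) ≤ ρ * (4 * y * (ρ - 1)) := by
      calc 4 * y * (γ / 2) ≤ 4 * y * (ρ - 1) := by gcongr
        _ ≤ _ := le_mul_of_one_le_left (mul_nonneg (by positivity) (by linarith)) hρ0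
    have h4 : γ * y * (1 + 4 * y) ≤ γ * y * 2 := by
      gcongr
      linarith
    linarith
  have key2 : (1 + γ) * (1 - w) * (k * (N + k)) ≤ (k + m) * (N + (k + m)) := by
    calc _ = k * N * ((1 + γ) * (1 - w) * (1 + 4 * y)) := by
          nth_rewrite 2 [← hx]; ring
      _ ≤ k * N * (ρ * (1 + 4 * y * ρ)) := by gcongr
      _ = ρ * k * (N + ρ * (4 * y * N)) := by ring
      _ = ρ * k * (N + ρ * k) := by rw [hx]
      _ ≤ _ := by gcongr
  rw [inv_mul_eq_div, div_div N (k * (N + k)), mul_comm (k * (N + k))]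
  gcongr

theorem Real.exp_neg_two_mul_le_one_sub {w : ℝ} (hw : 0 ≤ w) (hw' : w ≤ 1 / 2) :
    Real.exp (-(2 * w)) ≤ 1 - w := by
  rw [Real.exp_neg, inv_le_iff_one_le_mul₀' (Real.exp_pos _)]
  calc 1 ≤ (2 * w + 1) * (1 - w) := by nlinarith
    _ ≤ Real.exp (2 * w) * (1 - w) := by
      gcongr
      · linarith
      · exact Real.add_one_le_exp _

namespace GainMoments

variable {Ω : Type*} [MeasurableSpace Ω] {ν : Measure Ω} {Z : Ω → ℝ} {k m c : ℝ}

/-- In `1 / y - 1 / (N + y)` Jensen's inequality handles the subtracted term, so only `1 / y` causes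
a variance error, of size at most `(1 + c) / (k M)` with `M = k + m`. Relative to the potential at
`M` this is `O(1 / k)`, because `N / (N + M)` is bounded below. -/
theorem integral_convex_potential_le (h : GainMoments ν Z k m (m + c * k)) (hk : 1 ≤ k)
    (hc : 0 ≤ c) {N n : ℝ} (hN : 0 < N) (hn : k + m ≤ n) :
    ∫ ω, N / (Z ω * (N + Z ω)) ∂ν
      ≤ (1 + (1 + c) * (1 + n / N) / k) * (N / ((k + m) * (N + (k + m)))) := by
  have hm := h.nonneg
  have hR : ∀ y, 0 < y → N / (y * (N + y)) = y⁻¹ - (N + y)⁻¹ := fun y hy => by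
    have : 0 < N + y := by linarith
    field_simp; ring
  have e : ∫ ω, N / (Z ω * (N + Z ω)) ∂ν = ∫ ω, (Z ω)⁻¹ ∂ν - ∫ ω, (N + Z ω)⁻¹ ∂ν := by
    rw [← integral_sub (h.integrable_comp fun z => z⁻¹) (h.integrable_comp fun z => (N + z)⁻¹)]
    refine integral_congr_ae ?_
    filter_upwards [h.le_ae] with ω hω using hR _ (by linarith)
  rw [e]
  have h1 := h.integral_inv_le (by linarith)
  have h2 := h.inv_le_integral_inv_add (by linarith) hN.le
  have h3 : (m + c * k) / ((k + m) ^ 2 * k)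
      ≤ (1 + c) * (1 + n / N) / k * (N / ((k + m) * (N + (k + m)))) := by
    calc (m + c * k) / ((k + m) ^ 2 * k) ≤ ((1 + c) * (k + m)) / ((k + m) ^ 2 * k) := by
          gcongr
          nlinarith [mul_nonneg hc hm]
      _ = (1 + c) * 1 / k * (1 / (k + m)) := by field_simp
      _ ≤ (1 + c) * ((1 + n / N) * (N / (N + (k + m)))) / k * (1 / (k + m)) := by
          have : 1 ≤ (1 + n / N) * (N / (N + (k + m))) := by
            rw [← mul_div_assoc, one_le_div (by positivity)]
            have : (1 + n / N) * N = N + n := by field_simp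
            linarith
          gcongr
      _ = _ := by field_simp
  have h4 := hR (k + m) (by linarith)
  rw [add_mul, one_mul, h4]
  rw [h4] at h3
  linarith

/-- The mean of `(N / (y (N + y))) ^ s + D / y` decreases by the factor `exp (-s l)`. -/
theorem integral_potential_le {N s l c₀ C D : ℝ} (h : GainMoments ν Z k m (m + c * k))
    (hk : 1 ≤ k) (hN : 0 < N) (hs₀ : 0 ≤ s) (hs₁ : s ≤ 1)
    (hc₀ : 0 < c₀) (hc₀' : c₀ ≤ 1) (hC : 0 ≤ C) (hD : D = 2 * C / c₀)
    (hl : 1 - c₀ / 2 ≤ Real.exp (-s * l))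
    (hR : ∫ ω, N / (Z ω * (N + Z ω)) ∂ν ≤ (1 + C / k) * (Real.exp (-l) * (N / (k * (N + k)))))
    (hdiv : ∫ ω, k / Z ω ∂ν ≤ 1 - c₀) :
    ∫ ω, ((N / (Z ω * (N + Z ω))) ^ s + D / Z ω) ∂ν
      ≤ Real.exp (-s * l) * ((N / (k * (N + k))) ^ s + D / k) := by
  have hk0 : 0 < k := by linarith
  have hD0 : 0 ≤ D := by rw [hD]; positivity
  set Λ := Real.exp (-s * l)
  have hΛ0 : 0 < Λ := Real.exp_pos _
  set Rk := N / (k * (N + k)) with hRk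
  have hRk0 : 0 ≤ Rk := by positivity
  have hRk1 : Rk ^ s ≤ 1 := by
    refine Real.rpow_le_one hRk0 ?_ hs₀
    rw [hRk, div_le_one (by positivity)]
    nlinarith
  have hpow : ∫ ω, (N / (Z ω * (N + Z ω))) ^ s ∂ν ≤ (1 + C / k) * (Λ * Rk ^ s) := by
    calc _ ≤ (∫ ω, N / (Z ω * (N + Z ω)) ∂ν) ^ s :=
          h.integral_rpow_le (φ := fun z => N / (z * (N + z)))
            (fun z hz => by have : 0 < z := by linarith
                            positivity) hs₀ hs₁
      _ ≤ ((1 + C / k) * (Real.exp (-l) * Rk)) ^ s := by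
          refine Real.rpow_le_rpow (integral_nonneg_of_ae ?_) hR hs₀
          filter_upwards [h.le_ae] with ω hω
          have : 0 < Z ω := by linarith
          simp only [Pi.zero_apply]
          positivity
      _ = (1 + C / k) ^ s * (Λ * Rk ^ s) := by
          rw [Real.mul_rpow (by positivity) (by positivity),
            Real.mul_rpow (by positivity) hRk0, ← Real.exp_mul]
          simp only [Λ]
          ring_nf
      _ ≤ _ := by
          gcongr
          have h1 : 1 ≤ 1 + C / k := by
            have : 0 ≤ C / k := by positivity
            linarith
          calc (1 + C / k) ^ s ≤ (1 + C / k) ^ (1 : ℝ) :=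
                Real.rpow_le_rpow_of_exponent_le h1 hs₁
            _ = _ := Real.rpow_one _
  have hdiv' : ∫ ω, D / Z ω ∂ν ≤ D / k * (1 - c₀) := by
    have : ∀ ω, D / Z ω = D / k * (k / Z ω) := fun ω => by field_simp
    simp_rw [this]
    rw [integral_const_mul]
    gcongr
  rw [integral_add (h.integrable_comp fun z => (N / (z * (N + z))) ^ s)
    (h.integrable_comp fun z => D / z)]
  refine (add_le_add hpow hdiv').trans ?_
  -- The term `D / k` contracts by `1 - c₀` where only `Λ ≥ 1 - c₀ / 2` is demanded; with `D = 2 C /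
  -- c₀` this surplus covers the error `C / k`.
  have h5 : Λ * C ≤ D * (Λ - (1 - c₀)) := by
    rw [hD, div_mul_eq_mul_div, le_div_iff₀ hc₀]
    have : Λ * c₀ ≤ 2 * (Λ - (1 - c₀)) := by nlinarith
    nlinarith
  have h6 : C / k * (Λ * Rk ^ s) ≤ D / k * (Λ - (1 - c₀)) := by
    calc C / k * (Λ * Rk ^ s) ≤ C / k * (Λ * 1) := by gcongr
      _ = (Λ * C) / k := by ring
      _ ≤ (D * (Λ - (1 - c₀))) / k := by gcongr
      _ = _ := by ring
  linarith

end GainMoments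

namespace HomogeneousRumorProcess

variable {n : ℕ} {Ω : Type*} [MeasurableSpace Ω] {μ : Measure Ω}

/-- The two phases, up to `θ` and from `θ` to `m` informed nodes, combined. -/
theorem measureReal_count_lt_le [IsProbabilityMeasure μ]
    (P : HomogeneousRumorProcess n μ) {N θ m s D Λ Λ' : ℝ} (hθ : 0 < θ) (hθN : θ ≤ N)
    (hm : 0 < m) (hs₀ : 0 ≤ s) (hs₁ : s ≤ 1) (hD : 0 ≤ D) (hΛ : 0 ≤ Λ) (hΛ' : 0 ≤ Λ')
    (H : ∀ t h, μ (P.historyEvent t h) ≠ 0 → ((h t).card : ℝ) < θ →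
      ∫ ω, ((N / (P.count (t + 1) ω * (N + P.count (t + 1) ω))) ^ s + D / P.count (t + 1) ω)
        ∂μ[| P.historyEvent t h]
      ≤ Λ * ((N / ((h t).card * (N + (h t).card))) ^ s + D / (h t).card))
    (H' : ∀ t h, μ (P.historyEvent t h) ≠ 0 → ((h t).card : ℝ) < m →
      ∫ ω, ((P.count (t + 1) ω)⁻¹) ^ s ∂μ[| P.historyEvent t h]
      ≤ Λ' * (((h t).card : ℝ)⁻¹) ^ s) (t₁ t₂ : ℕ) :
    μ.real {ω | P.count (t₁ + t₂) ω < m}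
      ≤ m ^ s * (Λ' ^ t₂ * (2 * (Λ ^ t₁ * (1 + D)) + (θ⁻¹) ^ s)) := by
  have hN : 0 < N := hθ.trans_le hθN
  set g : ℝ → ℝ := fun y => (N / (y * (N + y))) ^ s + D / y with hg
  set g' : ℝ → ℝ := fun y => (y⁻¹) ^ s with hg'
  have hg0 : ∀ y, 1 ≤ y → 0 ≤ g y := fun y hy => by
    have : 0 < y := by linarith
    simp only [hg]; positivity
  have hg'0 : ∀ y, 1 ≤ y → 0 ≤ g' y := fun y hy => by
    have : 0 < y := by linarith
    simp only [hg']; positivity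
  have hphase1 : ∫ ω, (Set.Iio θ).indicator g (P.count t₁ ω) ∂μ ≤ Λ ^ t₁ * (1 + D) := by
    have h1 := P.integral_indicator_potential_le hg0 hΛ H 0 t₁
    rw [zero_add] at h1
    refine h1.trans ?_
    gcongr
    simp only [P.count_zero, integral_const, probReal_univ, smul_eq_mul, one_mul]
    refine (Set.indicator_le_self' (fun _ _ => hg0 1 le_rfl) 1).trans ?_
    simp only [hg, one_mul, div_one]
    gcongr
    refine Real.rpow_le_one (by positivity) ?_ hs₀
    rw [div_le_one (by positivity)]
    linarith
  -- Below `θ ≤ N` one has `1 / y ≤ 2 N / (y (N + y))`, so the first potential dominates the second;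
  -- from `θ` on, `y ^ (-s) ≤ θ ^ (-s)`.
  have hcompare : ∀ ω, (Set.Iio m).indicator g' (P.count t₁ ω)
      ≤ 2 * (Set.Iio θ).indicator g (P.count t₁ ω) + (θ⁻¹) ^ s := by
    intro ω
    have hy := P.one_le_count t₁ ω
    set y := P.count t₁ ω
    have hy0 : 0 < y := by linarith
    refine (Set.indicator_le_self' (fun _ _ => hg'0 y hy) y).trans ?_
    by_cases hyθ : y < θ
    · rw [Set.indicator_of_mem (show y ∈ Set.Iio θ from hyθ)]
      have h1 : g' y ≤ 2 * (N / (y * (N + y))) ^ s := by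
        calc g' y ≤ (2 * (N / (y * (N + y)))) ^ s := by
              refine Real.rpow_le_rpow (by positivity) ?_ hs₀
              rw [← mul_div_assoc, inv_le_comm₀ hy0 (by positivity), inv_div,
                div_le_iff₀ (by positivity)]
              nlinarith
          _ = 2 ^ s * (N / (y * (N + y))) ^ s := Real.mul_rpow (by norm_num) (by positivity)
          _ ≤ 2 ^ (1 : ℝ) * (N / (y * (N + y))) ^ s := by
              gcongr
              norm_num
          _ = _ := by rw [Real.rpow_one]
      have h2 : 0 ≤ D / y := by positivity
      have h3 : 0 ≤ (θ⁻¹) ^ s := by positivity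
      simp only [hg]
      linarith
    · rw [Set.indicator_of_notMem (show y ∉ Set.Iio θ from hyθ), mul_zero, zero_add]
      rw [not_lt] at hyθ
      simp only [hg']
      gcongr
  have hmid : ∫ ω, (Set.Iio m).indicator g' (P.count t₁ ω) ∂μ
      ≤ 2 * (Λ ^ t₁ * (1 + D)) + (θ⁻¹) ^ s := by
    have i1 := (P.integrable_comp_count t₁ ((Set.Iio θ).indicator g) μ).const_mul 2
    calc _ ≤ ∫ ω, (2 * (Set.Iio θ).indicator g (P.count t₁ ω) + (θ⁻¹) ^ s) ∂μ :=
          integral_mono (P.integrable_comp_count _ _ _) (i1.add (integrable_const _)) hcompare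
      _ = 2 * ∫ ω, (Set.Iio θ).indicator g (P.count t₁ ω) ∂μ + (θ⁻¹) ^ s := by
          rw [integral_add i1 (integrable_const _), integral_const_mul]
          simp
      _ ≤ _ := by gcongr
  have hphase2 := P.integral_indicator_potential_le hg'0 hΛ' H' t₁ t₂
  have hmarkov : μ.real {ω | P.count (t₁ + t₂) ω < m} * (m⁻¹) ^ s
      ≤ ∫ ω, (Set.Iio m).indicator g' (P.count (t₁ + t₂) ω) ∂μ := by
    rw [← integral_indicator_one (P.measurableSet_count_lt m _), ← integral_mul_const]
    refine integral_mono (((integrable_const 1).indicator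
      (P.measurableSet_count_lt m _)).mul_const _) (P.integrable_comp_count _ _ _) fun ω => ?_
    have hy := P.one_le_count (t₁ + t₂) ω
    simp only [Set.indicator, Set.mem_ofPred_eq, Set.mem_Iio, Pi.one_apply]
    split_ifs with hlt
    · simp only [hg', one_mul]
      gcongr
    · simp
  have hms : 0 < m ^ s := by positivity
  rw [Real.inv_rpow hm.le, ← div_eq_mul_inv, div_le_iff₀ hms] at hmarkov
  calc _ ≤ _ := hmarkov
    _ ≤ (Λ' ^ t₂ * (2 * (Λ ^ t₁ * (1 + D)) + (θ⁻¹) ^ s)) * m ^ s := by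
        gcongr
        exact hphase2.trans (by gcongr)
    _ = _ := mul_comm _ _

end HomogeneousRumorProcess

/-- The first bound gives a constant growth rate all the way to `f n`, where `a f < 1` keeps the
bracket positive. The second is sharp for small `k / n`: the proportion `1 - k / n` of uninformed
nodes is absorbed by replacing `a` with `1 + a`. -/
theorem mean_lower_bounds {n k p γ₀ γ a f w : ℝ} (hn : 0 < n) (hk : 0 ≤ k) (hkf : k ≤ f * n)
    (hkn : k ≤ n) (hγ₀ : 0 < γ₀) (hγ : γ₀ ≤ γ) (ha : 0 ≤ a) (hf : f < 1) (haf : a * f < 1)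
    (hw₀ : 0 ≤ w) (hw : w ≤ (1 - a * f) / 2) (hp : γ * (k / n) * (1 - a * (k / n) - w) ≤ p) :
    (1 - f) * γ₀ * ((1 - a * f) / 2) * k ≤ (n - k) * p ∧
      γ * k * (1 - (1 + a) * (k / n) - w) ≤ (n - k) * p := by
  obtain ⟨x, hx⟩ : ∃ x, x = k / n := ⟨_, rfl⟩
  rw [← hx] at hp ⊢
  have hkx : k = x * n := by rw [hx]; field_simp
  have hx0 : 0 ≤ x := hx ▸ by positivity
  have hxf : x ≤ f := by rw [hx, div_le_iff₀ hn]; exact hkf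
  have hax : (1 - a * f) / 2 ≤ 1 - a * x - w := by
    have : a * x ≤ a * f := mul_le_mul_of_nonneg_left hxf ha
    linarith
  have hax0 : 0 < (1 - a * f) / 2 := by linarith
  have hm : γ * k * ((1 - x) * (1 - a * x - w)) ≤ (n - k) * p := by
    calc _ = (n - k) * (γ * x * (1 - a * x - w)) := by rw [hkx]; ring
      _ ≤ _ := mul_le_mul_of_nonneg_left hp (sub_nonneg.2 hkn)
  have hγk : 0 ≤ γ * k := mul_nonneg (by linarith) hk
  constructor
  · refine le_trans ?_ hm
    calc (1 - f) * γ₀ * ((1 - a * f) / 2) * k = γ₀ * k * ((1 - f) * ((1 - a * f) / 2)) := by ring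
      _ ≤ γ * k * ((1 - x) * (1 - a * x - w)) := by
          refine mul_le_mul (mul_le_mul_of_nonneg_right hγ hk) ?_ ?_ hγk
          · exact mul_le_mul (by linarith) hax hax0.le (by linarith)
          · exact mul_nonneg (by linarith) hax0.le
  · refine le_trans ?_ hm
    refine mul_le_mul_of_nonneg_left ?_ hγk
    have := mul_nonneg hx0 (mul_nonneg ha hx0)
    nlinarith

/-- In the first-phase term the `L` basic rounds cancel `n ^ s`, up to the bounded factor from `w
L`, and the `r / 2` surplus rounds give the decay. In the other term `n ^ s (ε n) ^ (-s)` is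
constant and the decay comes from `t₂`. -/
theorem tail_estimate {n s b c₀ l₀ l₁ lg w L D ε α : ℝ} {t₁ t₂ r : ℕ} (hn : 0 < n) (hs : 0 < s)
    (hc₀ : 0 < c₀) (hl₀ : l₀ ≤ lg) (hl₁ : lg ≤ l₁) (hw₀ : 0 ≤ w)
    (hw : w ≤ l₀ / 4) (hwL : w * L ≤ b / l₀) (hL : L * lg = Real.log n) (hD : 0 ≤ D) (hε : 0 < ε)
    (hα₁ : α ≤ s * l₀ / 4) (hα₂ : α ≤ s * c₀ / 2) (ht₁ : L + r / 2 - 1 ≤ t₁)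
    (ht₂ : (r : ℝ) / 2 - 1 / 2 ≤ t₂) :
    n ^ s * (Real.exp (-s * c₀) ^ t₂ *
      (2 * (Real.exp (-s * (lg - 2 * w)) ^ t₁ * (1 + D)) + ((ε * n)⁻¹) ^ s))
    ≤ (2 * (1 + D) * Real.exp (s * (2 * b / l₀ + l₁)) + (ε⁻¹) ^ s * Real.exp (s * c₀ / 2))
      * Real.exp (-α * r) := by
  have hr0 : (0 : ℝ) ≤ r := Nat.cast_nonneg r
  have e1 : Real.exp (-s * c₀) ^ t₂ ≤ Real.exp (s * c₀ / 2) * Real.exp (-α * r) := by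
    rw [← Real.exp_nat_mul, ← Real.exp_add, Real.exp_le_exp]
    have h1 := mul_le_mul_of_nonneg_left ht₂ (mul_pos hs hc₀).le
    have h2 := mul_le_mul_of_nonneg_right hα₂ hr0
    linarith
  have e1' : Real.exp (-s * c₀) ^ t₂ ≤ 1 := by
    refine pow_le_one₀ (Real.exp_pos _).le ?_
    rw [← Real.exp_zero, Real.exp_le_exp]
    have := mul_pos hs hc₀
    linarith
  have e2 : n ^ s * Real.exp (-s * (lg - 2 * w)) ^ t₁
      ≤ Real.exp (s * (2 * b / l₀ + l₁)) * Real.exp (-α * r) := by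
    rw [Real.rpow_def_of_pos hn, ← Real.exp_nat_mul, ← Real.exp_add, ← Real.exp_add,
      Real.exp_le_exp, ← hL]
    have h1 := mul_le_mul_of_nonneg_left ht₁ (by linarith : 0 ≤ lg - 2 * w)
    have h2 : l₀ / 2 * (r / 2) ≤ (lg - 2 * w) * (r / 2) :=
      mul_le_mul_of_nonneg_right (by linarith) (by linarith)
    have h3 : 2 * b / l₀ = 2 * (b / l₀) := by ring
    have h5 : L * lg - (lg - 2 * w) * t₁ ≤ 2 * b / l₀ + l₁ - l₀ / 4 * r := by
      rw [h3]
      linarith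
    have h6 := mul_le_mul_of_nonneg_left h5 hs.le
    have h7 := mul_le_mul_of_nonneg_right hα₁ hr0
    linarith
  have e3 : n ^ s * ((ε * n)⁻¹) ^ s = (ε⁻¹) ^ s := by
    rw [← Real.mul_rpow hn.le (by positivity)]
    congr 1
    field_simp
  have e4 : 0 ≤ 2 * (1 + D) * (n ^ s * Real.exp (-s * (lg - 2 * w)) ^ t₁) := by positivity
  have e5 : 0 ≤ (ε⁻¹) ^ s := by positivity
  calc _ = Real.exp (-s * c₀) ^ t₂ * (2 * (1 + D) * (n ^ s * Real.exp (-s * (lg - 2 * w)) ^ t₁))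
        + Real.exp (-s * c₀) ^ t₂ * (n ^ s * ((ε * n)⁻¹) ^ s) := by ring
    _ ≤ 2 * (1 + D) * (Real.exp (s * (2 * b / l₀ + l₁)) * Real.exp (-α * r))
        + (Real.exp (s * c₀ / 2) * Real.exp (-α * r)) * (ε⁻¹) ^ s := by
        rw [e3]
        refine add_le_add ((mul_le_of_le_one_left e4 e1').trans ?_)
          (mul_le_mul_of_nonneg_right e1 e5)
        exact mul_le_mul_of_nonneg_left e2 (by linarith)
    _ = _ := by ring

theorem spreadingTime_of_upperExpGrowth (γ₀ γ₁ a b c f : ℝ) (hγ₀ : 0 < γ₀) (hγ : γ₀ ≤ γ₁)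
    (ha : 0 ≤ a) (hb : 0 ≤ b) (hc : 0 ≤ c) (hf₀ : 0 < f) (hf₁ : f < 1) (haf : a * f < 1) :
    ∃ (C A' α' : ℝ) (N : ℕ), 0 < A' ∧ 0 < α' ∧
        ∀ (n : ℕ), N ≤ n →
        ∀ (Ω : Type*) [MeasurableSpace Ω] (μ : Measure Ω) [IsProbabilityMeasure μ]
          (P : HomogeneousRumorProcess n μ) (γ : ℝ), γ₀ ≤ γ → γ ≤ γ₁ →
          P.UpperExpGrowth γ a b c f →
            ∫⁻ ω, (P.spreadingTime (f * n) ω : ℝ≥0∞) ∂μ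
                ≤ ENNReal.ofReal (Real.logb (1 + γ) n + C) ∧
            ∀ r : ℕ,
              μ {ω | ∀ t : ℕ, P.spreadingTime (f * n) ω = t → Real.logb (1 + γ) n + r ≤ t}
                ≤ ENNReal.ofReal (A' * Real.exp (-α' * r)) := by
  have hf1 : 0 < 1 - f := by linarith
  have haf1 : 0 < 1 - a * f := by linarith
  set δ := (1 - f) * γ₀ * ((1 - a * f) / 2) with hδ
  have hδ0 : 0 < δ := by positivity
  set c₀ := δ ^ 2 / (δ ^ 2 + 2 * δ + c) with hc₀
  have hc₀0 : 0 < c₀ := by positivity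
  have hc₀1 : c₀ ≤ 1 := by
    rw [hc₀, div_le_one (by positivity)]
    nlinarith
  set l₀ := Real.log (1 + γ₀) with hl₀
  set l₁ := Real.log (1 + γ₁) with hl₁
  have hl₀0 : 0 < l₀ := Real.log_pos (by linarith)
  have hl₁0 : 0 < l₁ := Real.log_pos (by linarith)
  -- So small that the required factor `exp (-s l)` is at least `1 - c₀ / 2`, weaker than the
  -- contraction `1 - c₀` of `1 / y`.
  obtain ⟨s, hs0, hs1, hsl⟩ : ∃ s, 0 < s ∧ s ≤ 1 ∧ s * l₁ ≤ c₀ / 2 := by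
    refine ⟨min 1 (c₀ / 2 / l₁), lt_min one_pos (by positivity), min_le_left _ _, ?_⟩
    rw [← le_div_iff₀ hl₁0]
    exact min_le_right _ _
  set η := 4 * (1 + a) with hη
  have hη0 : 0 < η := by positivity
  obtain ⟨ε, hε0, hεf, hεη⟩ : ∃ ε, 0 < ε ∧ ε ≤ f ∧ ε ≤ 1 / η :=
    ⟨min f (1 / η), lt_min hf₀ (by positivity), min_le_left _ _, min_le_right _ _⟩
  set C₁ := (1 + c) * (1 + η) with hC₁
  have hC₁0 : 0 < C₁ := by positivity
  set D := 2 * C₁ / c₀ with hD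
  have hD0 : 0 < D := by positivity
  set A := 2 * (1 + D) * Real.exp (s * (2 * b / l₀ + l₁)) + (ε⁻¹) ^ s * Real.exp (s * c₀ / 2) with hA
  have hA0 : 0 < A := by positivity
  obtain ⟨α, hα0, hα1, hα2⟩ : ∃ α, 0 < α ∧ α ≤ s * l₀ / 4 ∧ α ≤ s * c₀ / 2 :=
    ⟨min (s * l₀ / 4) (s * c₀ / 2), lt_min (by positivity) (by positivity), min_le_left _ _,
      min_le_right _ _⟩
  -- The three bounds on `w` serve the decay of the convex potential, the positivity of the rate `lg
  -- - 2 w`, and the linear lower bound on the gain.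
  obtain ⟨N₀, hN₀⟩ : ∃ N₀ : ℕ, ∀ n : ℕ, N₀ ≤ n →
      b / Real.log n ≤ min (1 / 4) (min (l₀ / 4) ((1 - a * f) / 2)) := by
    have h1 : Filter.Tendsto (fun n : ℕ => b / Real.log n) Filter.atTop (nhds 0) :=
      (Real.tendsto_log_atTop.comp tendsto_natCast_atTop_atTop).const_div_atTop b
    exact Filter.eventually_atTop.1 (h1.eventually_le_const (by positivity))
  refine ⟨1 + A * (1 - Real.exp (-α))⁻¹, A, α, N₀ + 3, hA0, hα0, ?_⟩
  intro n hn Ω _ μ _ P γ hγ0 hγ1 hP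
  have hn3 : (3 : ℝ) ≤ n := by exact_mod_cast (by omega : 3 ≤ n)
  have hn0 : (0 : ℝ) < n := by linarith
  have hlog : 0 < Real.log n := Real.log_pos (by linarith)
  have hγpos : 0 < γ := by linarith
  set w := b / Real.log n with hw
  have hw0 : 0 ≤ w := by positivity
  obtain ⟨hw1, hw2, hw3⟩ : w ≤ 1 / 4 ∧ w ≤ l₀ / 4 ∧ w ≤ (1 - a * f) / 2 := by
    have := hN₀ n (by omega)
    rw [le_min_iff, le_min_iff] at this
    exact this
  set lg := Real.log (1 + γ) with hlg
  have hlg0 : l₀ ≤ lg := Real.log_le_log (by linarith) (by linarith)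
  have hlg1 : lg ≤ l₁ := Real.log_le_log (by linarith) (by linarith)
  set L := Real.logb (1 + γ) n with hL
  have hL0 : 0 < L := Real.logb_pos (by linarith) (by linarith)
  have hLlg : L * lg = Real.log n := by
    have : lg ≠ 0 := by linarith
    rw [hL, Real.logb, div_mul_cancel₀ _ this]
  have hwL : w * L ≤ b / l₀ := by
    have : w * L = b / lg := by
      have : lg ≠ 0 := by linarith
      rw [hw, ← hLlg]; field_simp
    rw [this]
    gcongr
  set l := lg - 2 * w with hl
  have hround : ∀ t h, μ (P.historyEvent t h) ≠ 0 → ((h t).card : ℝ) < f * n →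
      GainMoments (μ[| P.historyEvent t h]) (P.count (t + 1)) (h t).card (P.meanGain (h t).card)
        (P.meanGain (h t).card + c * (h t).card) ∧ (1 : ℝ) ≤ (h t).card ∧
      δ * (h t).card ≤ P.meanGain (h t).card ∧
      γ * (h t).card * (1 - (1 + a) * ((h t).card / n) - w) ≤ P.meanGain (h t).card := by
    intro t h hpos hk
    obtain ⟨hp, hcov⟩ := hP _ (P.card_history_pos t h hpos) hk
    have hk1 : (1 : ℝ) ≤ (h t).card := by exact_mod_cast P.card_history_pos t h hpos
    refine ⟨P.gainMoments_of_le t h hpos (by omega) hc hcov, hk1, ?_⟩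
    exact mean_lower_bounds hn0 (Nat.cast_nonneg _) hk.le (card_history_le t h) hγ₀ hγ0 ha hf₁ haf
      hw0 hw3 hp
  set N := (n : ℝ) / η with hN
  have hN0 : 0 < N := by positivity
  have hεN : ε * n ≤ N := by
    calc ε * n ≤ 1 / η * n := by gcongr
      _ = _ := by rw [hN]; ring
  have hl0 : 0 ≤ l := by rw [hl]; linarith
  have hΛl : 1 - c₀ / 2 ≤ Real.exp (-s * l) := by
    have h1 : s * l ≤ s * l₁ := by
      gcongr
      rw [hl]; linarith
    have h2 := Real.add_one_le_exp (-s * l)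
    linarith
  have hexpl : ((1 + γ) * (1 - w))⁻¹ ≤ Real.exp (-l) := by
    have h1 := Real.exp_neg_two_mul_le_one_sub hw0 (by linarith)
    have h2 : Real.exp lg = 1 + γ := Real.exp_log (by linarith)
    have h3 : Real.exp l ≤ (1 + γ) * (1 - w) := by
      rw [hl, sub_eq_add_neg, Real.exp_add, h2]
      gcongr
    rw [Real.exp_neg]
    gcongr
  have hmain : ∀ t₁ t₂ : ℕ, μ.real {ω | P.count (t₁ + t₂) ω < f * n}
      ≤ (f * n) ^ s * (Real.exp (-s * c₀) ^ t₂ *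
        (2 * (Real.exp (-s * l) ^ t₁ * (1 + D)) + ((ε * n)⁻¹) ^ s)) := by
    refine P.measureReal_count_lt_le (by positivity) hεN (by positivity) hs0.le hs1 hD0.le
      (Real.exp_pos _).le (Real.exp_pos _).le ?_ ?_
    · intro t h hpos hk
      obtain ⟨hM, hk1, hmδ, hmγ⟩ := hround t h hpos (hk.trans_le (by gcongr))
      have hkm : ((h t).card : ℝ) + P.meanGain (h t).card ≤ n := by
        have := hM.isProbabilityMeasure
        rw [← hM.integral_eq]
        calc _ ≤ ∫ _, (n : ℝ) ∂μ[| P.historyEvent t h] :=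
              integral_mono (P.integrable_count _ _) (integrable_const _) (P.count_le _)
          _ = n := by simp
      refine hM.integral_potential_le hk1 hN0 hs0.le hs1 hc₀0 hc₀1 hC₁0.le hD hΛl ?_
        (hM.integral_div_le hk1 hδ0 hc hmδ)
      refine (hM.integral_convex_potential_le hk1 hc hN0 hkm).trans ?_
      have hnN : (n : ℝ) / N = η := by rw [hN]; field_simp
      rw [hnN]
      gcongr
      refine (convex_potential_decay hn0 (by linarith) hγpos.le (by linarith : 1 ≤ 1 + a) hw0 hw1
        (hk.le.trans hεN) hmγ).trans ?_
      gcongr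
    · intro t h hpos hk
      obtain ⟨hM, hk1, hmδ, -⟩ := hround t h hpos hk
      have hk0 : (0 : ℝ) < (h t).card := by linarith
      have h1 := hM.integral_div_le hk1 hδ0 hc hmδ
      have h2 : ∫ ω, (P.count (t + 1) ω)⁻¹ ∂μ[| P.historyEvent t h]
          ≤ Real.exp (-c₀) * ((h t).card : ℝ)⁻¹ := by
        simp_rw [div_eq_mul_inv] at h1
        rw [integral_const_mul] at h1
        rw [← div_eq_mul_inv, le_div_iff₀ hk0, mul_comm]
        refine h1.trans ?_
        have := Real.add_one_le_exp (-c₀)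
        simp only [hc₀, div_eq_mul_inv] at this ⊢
        linarith
      calc _ ≤ (∫ ω, (P.count (t + 1) ω)⁻¹ ∂μ[| P.historyEvent t h]) ^ s :=
            hM.integral_rpow_le (φ := fun z => z⁻¹)
              (fun z hz => inv_nonneg.2 (by linarith)) hs0.le hs1
        _ ≤ (Real.exp (-c₀) * ((h t).card : ℝ)⁻¹) ^ s := by
            refine Real.rpow_le_rpow (integral_nonneg fun ω => ?_) h2 hs0.le
            exact inv_nonneg.2 (by linarith [P.one_le_count (t + 1) ω])
        _ = _ := by
            rw [Real.mul_rpow (Real.exp_pos _).le (by positivity), ← Real.exp_mul]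
            ring_nf
  have htail : ∀ t r : ℕ, L + r - 1 ≤ t →
      μ {ω | P.count t ω < f * n} ≤ ENNReal.ofReal (A * Real.exp (-α * r)) := by
    intro t r htr
    rw [← ofReal_measureReal]
    refine ENNReal.ofReal_le_ofReal ?_
    -- `L > 0` gives `r ≤ t`, so `t` splits into the integer part of `r / 2` for the second phase
    -- and the remaining rounds for the first.
    have hrt : r / 2 ≤ t := by
      have h1 : (r : ℝ) < t + 1 := by linarith
      have h2 : r < t + 1 := by exact_mod_cast h1
      omega
    obtain ⟨t₁, rfl⟩ := Nat.exists_eq_add_of_le' hrt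
    have hr1 : ((r / 2 : ℕ) : ℝ) ≤ r / 2 := Nat.cast_div_le
    have hr2 : (r : ℝ) / 2 - 1 / 2 ≤ ((r / 2 : ℕ) : ℝ) := by
      have : r ≤ 2 * (r / 2) + 1 := by omega
      have : (r : ℝ) ≤ 2 * ((r / 2 : ℕ) : ℝ) + 1 := by exact_mod_cast this
      linarith
    push_cast at htr
    set t₂ := r / 2
    have ht₁ : L + r / 2 - 1 ≤ t₁ := by linarith
    refine (hmain t₁ t₂).trans (le_trans ?_ (tail_estimate hn0 hs0 hc₀0 hlg0 hlg1 hw0 hw2 hwL hLlg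
      hD0.le hε0 hα1 hα2 ht₁ hr2))
    refine mul_le_mul_of_nonneg_right ?_ (by positivity)
    exact Real.rpow_le_rpow (by positivity) (mul_le_of_le_one_left hn0.le hf₁.le) hs0.le
  exact ⟨P.lintegral_spreadingTime_le hA0.le hα0 hL0.le htail,
    fun r => P.measure_add_le_spreadingTime hL0 fun t ht => htail t r ht⟩

theorem mainTheorem1 (γ₀ γ₁ a b c f : ℝ) (hγ₀ : 0 < γ₀) (hγ : γ₀ ≤ γ₁)
    (ha : 0 ≤ a) (hb : 0 ≤ b) (hc : 0 ≤ c) (hf₀ : 0 < f) (hf₁ : f < 1) :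
    -- upper exponential growth conditions: upper bounds for the spreading time
    (a * f < 1 →
      ∃ (C A' α' : ℝ) (N : ℕ), 0 < A' ∧ 0 < α' ∧
        ∀ (n : ℕ), N ≤ n →
        ∀ (Ω : Type*) [MeasurableSpace Ω] (μ : Measure Ω) [IsProbabilityMeasure μ]
          (P : HomogeneousRumorProcess n μ) (γ : ℝ), γ₀ ≤ γ → γ ≤ γ₁ →
          P.UpperExpGrowth γ a b c f →
            ∫⁻ ω, (P.spreadingTime (f * n) ω : ℝ≥0∞) ∂μ
                ≤ ENNReal.ofReal (Real.logb (1 + γ) n + C) ∧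
            ∀ r : ℕ,
              μ {ω | ∀ t : ℕ, P.spreadingTime (f * n) ω = t → Real.logb (1 + γ) n + r ≤ t}
                ≤ ENNReal.ofReal (A' * Real.exp (-α' * r))) ∧
    -- lower exponential growth conditions: lower bounds for the spreading time
    (∃ (C A' α' : ℝ) (N : ℕ), 0 < A' ∧ 0 < α' ∧
        ∀ (n : ℕ), N ≤ n →
        ∀ (Ω : Type*) [MeasurableSpace Ω] (μ : Measure Ω) [IsProbabilityMeasure μ]
          (P : HomogeneousRumorProcess n μ) (γ : ℝ), γ₀ ≤ γ → γ ≤ γ₁ →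
          P.LowerExpGrowth γ a b c f →
            ENNReal.ofReal (Real.logb (1 + γ) n - C)
                ≤ ∫⁻ ω, (P.spreadingTime (f * n) ω : ℝ≥0∞) ∂μ ∧
            ∀ r : ℕ,
              μ {ω | ∃ t : ℕ, P.spreadingTime (f * n) ω = t ∧ (t : ℝ) ≤ Real.logb (1 + γ) n - r}
                ≤ ENNReal.ofReal (A' * Real.exp (-α' * r))) ∧
    -- lower exponential growth conditions: no overshooting when `f n` is first reached
    (∀ (κ q : ℝ), 0 < κ → q < 1 →
      ∃ (f' D : ℝ) (N : ℕ), f < f' ∧ f' < 1 ∧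
        ∀ (n : ℕ), N ≤ n →
        ∀ (Ω : Type*) [MeasurableSpace Ω] (μ : Measure Ω) [IsProbabilityMeasure μ]
          (P : HomogeneousRumorProcess n μ) (γ : ℝ), γ₀ ≤ γ → γ ≤ γ₁ →
          P.LowerExpGrowth γ a b c f →
          (∀ k : ℕ, 1 ≤ k → (k : ℝ) < f * n → κ * (k / n) ≤ P.p k ∧ P.p k ≤ q) →
            μ {ω | ∃ t : ℕ, P.spreadingTime (f * n) ω = t ∧
                f' * n < ((P.informed t ω).card : ℝ)}
              ≤ ENNReal.ofReal (D / n)) := by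
  exact ⟨fun haf => spreadingTime_of_upperExpGrowth γ₀ γ₁ a b c f hγ₀ hγ ha hb hc hf₀ hf₁ haf,
    spreadingTime_of_lowerExpGrowth γ₀ γ₁ a b c f hγ₀ ha hb hf₀ hf₁,
    fun κ q hκ hq => overshoot_of_lowerExpGrowth γ₀ γ₁ a b c f hγ₀ hγ ha hb hc hf₀ hf₁ κ q hκ hq⟩
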